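/- All graphs are finite and may have loops and parallel edges; a loop contributes $2$ to the degree of its node. A $\{1,3\}$-graph is a graph all of whose nodes have degree $1$ or $3$; nodes of degree $3$ are called internal. For a $\{1,3\}$-graph $G$ with edge set $E$ and set $I$ of internal nodes, let $\mathcal P_G\subset\mathbb R^E$ be the polytope of all $w$ such that, for every internal node $v$ with incident edges $a,b,c$ (a loop being listed twice), $$w_a\le w_b+w_c,\qquad w_b\le w_a+w_c,\qquad w_c\le w_a+w_b,\qquad w_a+w_b+w_c\le 1,$$ and $0\le w_e\le \tfrac12$ for every edge $e$ that alone is a component of $G$. Let $\mathcal Q_G\subset\mathbb R^E\times\mathbb R^I$ be the polytope of all $(w,z)$ such that, for every internal node $v$ with incident edges $a,b,c$, the same three triangle inequalities hold together with $w_a+w_b+w_c=2z_v$ and $z_v\le 1$, and $0\le w_e\le 1$ for every edge $e$ that alone is a component of $G$. For an integer $t\ge 0$ let $L^{\mathcal P}_G(t)=|t\mathcal P_G\cap\mathbb Z^E|$ and $L^{\mathcal Q}_G(t)=|t\mathcal Q_G\cap(\mathbb Z^E\times\mathbb Z^I)|$. A function $f$ on the nonnegative integers is a quasi-polynomial if for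 some $\alpha\ge1$ there are polynomials $f_0,\dots,f_{\alpha-1}$ with $f(t)=f_i(t)$ whenever $t\equiv i \pmod\alpha$; the least such $\alpha$ is its period. **Theorem.** Let $G$ be a connected $\{1,3\}$-graph. Then $L^{\mathcal P}_G$ is a quasi-polynomial; its period is at most $2$ if $G$ is a tree or a cubic graph (all nodes of degree $3$), and is exactly $4$ otherwise. Moreover, let $G$ be cubic with $n$ nodes and $m$ edges, let $k=m-n+1$ be its cyclomatic number, and let $N_G$ be the number of internally Eulerian subgraphs of $G$, that is, of sets of edges for which every internal node is incident to exactly zero or two of the edges (a loop counting twice). Then there are polynomials $p_0,p_1,p_2,p_3$ with $L^{\mathcal P}_G(t)=p_i(t)$ for all integers $t\ge 0$ with $t\equiv i\pmod 4$, and $q_0,q_1$ with $L^{\mathcal Q}_G(t)=q_i(t)$ for all integers $t\ge 0$ with $t\equiv i\pmod 2$, and for every real $t$ $$q_0(t)=N_G\,p_0(t)-(N_G-1)\Bigl(\tfrac t2+1\Bigr)^{k-1}=N_G\,p_2(t)-(N_G-1)\Bigl(\tfrac t2+1\Bigr)^{k-1}.$$ -/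

import Mathlib

open scoped Graph Pointwise

/-! Multigraphs (loops and parallel edges allowed) are Mathlib's `Graph α β`. -/

namespace Graph

variable {α β : Type*}

/-- The degree of a vertex; a loop counts twice. -/
noncomputable def degree (G : Graph α β) (v : α) : ℕ :=
  (G.incidenceSet v).ncard + (G.loopSet v).ncard

/-- A connected graph: nonempty, and any two vertices are joined by a walk. -/
def IsConnected (G : Graph α β) : Prop :=
  V(G).Nonempty ∧ ∀ x ∈ V(G), ∀ y ∈ V(G), Relation.ReflTransGen G.Adj x y

/-- No cycles. A cycle of length `n + 1 ≥ 1` consists of distinct vertices `x 0, …, x n` and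
distinct edges `e 0, …, e n`, where `e i` joins `x i` to `x (i + 1)` (indices cyclic).
A loop is a cycle of length 1, two parallel edges form a cycle of length 2. -/
def IsAcyclic (G : Graph α β) : Prop :=
  ∀ (n : ℕ) (x : Fin (n + 1) → α) (e : Fin (n + 1) → β),
    Function.Injective x → Function.Injective e → ¬ ∀ i, G.IsLink (e i) (x i) (x (i + 1))

/-- A tree. -/
def IsTree (G : Graph α β) : Prop := G.IsConnected ∧ G.IsAcyclic

/-- A cubic graph. -/
def IsCubic (G : Graph α β) : Prop := ∀ v ∈ V(G), G.degree v = 3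

/-- Every vertex has degree 1 or 3. -/
def IsOneThree (G : Graph α β) : Prop := ∀ v ∈ V(G), G.degree v = 1 ∨ G.degree v = 3

/-- The internal nodes: the vertices of degree 3. -/
def internalNodes (G : Graph α β) : Set α := {v | v ∈ V(G) ∧ G.degree v = 3}

/-- The cyclomatic number `m - n + 1`, for `m` edges and `n` vertices
(a connected finite graph has `n ≤ m + 1`, so nothing is truncated there). -/
noncomputable def cyclomaticNumber (G : Graph α β) : ℕ := E(G).ncard + 1 - V(G).ncard

/-- The number of internally Eulerian subgraphs (given by their edge sets `S`): every
internal node of `G` has degree 0 or 2 in the subgraph. -/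
noncomputable def numInternallyEulerian (G : Graph α β) : ℕ :=
  {S : Set β | S ⊆ E(G) ∧
    ∀ v ∈ G.internalNodes, (G.restrict S).degree v = 0 ∨ (G.restrict S).degree v = 2}.ncard

open Classical in
/-- `a, b, c` are the three edges at the vertex `v`, in some order, a loop at `v` being listed
twice. -/
def EdgesAt (G : Graph α β) (v : α) (a b c : E(G)) : Prop :=
  ∀ e : E(G), (if e = a then 1 else 0) + (if e = b then 1 else 0) + (if e = c then 1 else 0) =
    (if G.Inc e v then 1 else 0) + (if G.IsLoopAt e v then 1 else 0)

/-- The edge `e` alone is a component of `G`. -/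
def IsEdgeComponent (G : Graph α β) (e : E(G)) : Prop :=
  ∀ (f : β) (x : α), G.Inc e x → G.Inc f x → f = e

/-- The Liu–Osserman polytope `P_G` in `ℝ^E`. -/
def polytopeP (G : Graph α β) : Set (E(G) → ℝ) :=
  {w | (∀ v ∈ G.internalNodes, ∀ a b c : E(G), G.EdgesAt v a b c →
          w a ≤ w b + w c ∧ w b ≤ w a + w c ∧ w c ≤ w a + w b ∧ w a + w b + w c ≤ 1) ∧
        ∀ e : E(G), G.IsEdgeComponent e → 0 ≤ w e ∧ w e ≤ 1 / 2}

/-- The Liu–Osserman polytope `Q_G` in `ℝ^E × ℝ^I`, where `I` is the set of internal nodes. -/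
def polytopeQ (G : Graph α β) : Set (E(G) ⊕ G.internalNodes → ℝ) :=
  {y | (∀ v : G.internalNodes, ∀ a b c : E(G), G.EdgesAt v a b c →
          y (.inl a) ≤ y (.inl b) + y (.inl c) ∧
          y (.inl b) ≤ y (.inl a) + y (.inl c) ∧
          y (.inl c) ≤ y (.inl a) + y (.inl b) ∧
          y (.inl a) + y (.inl b) + y (.inl c) = 2 * y (.inr v) ∧
          y (.inr v) ≤ 1) ∧
        ∀ e : E(G), G.IsEdgeComponent e → 0 ≤ y (.inl e) ∧ y (.inl e) ≤ 1}

end Graph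

/-- The Ehrhart counting function: the number of integer points in the dilate `t P`. -/
noncomputable def ehrhart {ι : Type*} (P : Set (ι → ℝ)) (t : ℕ) : ℕ :=
  {z : ι → ℤ | (fun i => (z i : ℝ)) ∈ (t : ℝ) • P}.ncard

/-- The polynomials `p 0, …, p (n - 1)` represent `f` on the residue classes modulo `n`. -/
def IsConstituents {n : ℕ} (f : ℕ → ℕ) (p : Fin n → Polynomial ℝ) : Prop :=
  ∀ (t : ℕ) (i : Fin n), t % n = i → (f t : ℝ) = (p i).eval (t : ℝ)

/-- `f` is a quasi-polynomial whose period, the least possible number of constituents, is `n`. -/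
def HasPeriod (f : ℕ → ℕ) (n : ℕ) : Prop :=
  IsLeast {m : ℕ | 0 < m ∧ ∃ p : Fin m → Polynomial ℝ, IsConstituents f p} n

open Finset

/-! ### Finite trigonometric sums -/

/-! Write n = t + 2. Lattice points of the dilates are edge labelings that satisfy a local condition
at every internal node, and this condition is a fusion rule of SU(2) at level t. A label a stands
for the representation of dimension a + 1 in the case of Q, where integrality of z_v is the parity
condition, and of dimension 2a + 1 in the case of P, where parity is automatic. By
`sum_sin_mul_sin_mul_sin_div` (a Verlinde formula) the indicator of an admissible triple is ∑_j
ω_j⁻¹ χ_j(a) χ_j(b) χ_j(c), with χ_j a quotient of sines and ω_j its square norm.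

Expanding the product over nodes puts an index j at every node. Summing over the label of an edge
between internal nodes forces the indices at its two ends to agree, so connectedness leaves one
index. By `TrivalentNet.state_sum` the count is ∑_j ω_j^(i - v) λ_j^l, with v internal nodes, i
edges between internal nodes, l leaf edges and λ_j = ∑_a χ_j(a). Here i - v is the cyclomatic number
minus 1.

On odd dimensions χ_j = χ_(n-j), so for P the indices are folded. For odd t there is no fixed index.
For t = 2s the middle index is fixed: its norm is twice the generic value, and its λ is 1 or 0
according to the parity of s. If there are both leaves and a cycle, this term separates t ≡ 0 from t
≡ 2 modulo 4 (`exists_polynomial_even_leaf`). Without leaves λ does not occur; for trees the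
exponent of ω is -1, and the doubled norm is just what unfolds the sum, so the parity of s drops
out.

What remains are sums of even powers of cosecants, which are polynomial in n
(`exists_polynomial_cscSum`); for odd t, partial fractions separate the sines from the cosines. For
cubic graphs the counts for P (t even) and for Q involve the same cosecant sum with exponent k - 1.
Since N_G = 2^k, eliminating it gives the stated identity. -/

theorem two_mul_sin_half_mul_sum_cos (x : ℝ) (n : ℕ) :
    2 * Real.sin (x / 2) * ∑ a ∈ range n, Real.cos (a * x) =
      Real.sin ((n - 1 / 2) * x) + Real.sin (x / 2) := by
  induction n with
  | zero =>
    have : (((0 : ℕ) : ℝ) - 1 / 2) * x = -(x / 2) := by push_cast; ring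
    rw [this, Real.sin_neg]
    simp
  | succ n ih =>
    rw [sum_range_succ, mul_add, ih]
    have h1 : ((n : ℝ) - 1 / 2) * x = n * x - x / 2 := by ring
    have h2 : (((n + 1 : ℕ) : ℝ) - 1 / 2) * x = n * x + x / 2 := by push_cast; ring
    rw [h1, h2, Real.sin_add, Real.sin_sub]
    ring

theorem sin_int_mul_pi_div_ne_zero {n : ℕ} (hn : 0 < n) {k : ℤ} (hk : ¬ (n : ℤ) ∣ k) :
    Real.sin (k * Real.pi / n) ≠ 0 := by
  have hn' : (n : ℝ) ≠ 0 := by positivity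
  rw [Real.sin_ne_zero_iff]
  intro m hm
  apply hk
  refine ⟨m, ?_⟩
  have : (m * n : ℝ) = k := by
    have := Real.pi_ne_zero
    field_simp at hm
    exact hm
  have h : (m * n : ℤ) = k := by exact_mod_cast this
  rw [← h]; ring

theorem sin_nat_mul_pi_div_pos {n j : ℕ} (hj : 0 < j) (hjn : j < n) :
    0 < Real.sin (j * Real.pi / n) := by
  have hn : (0 : ℝ) < n := by exact_mod_cast hj.trans hjn
  have hj' : (0 : ℝ) < j := by exact_mod_cast hj
  have h : (j : ℝ) < n := by exact_mod_cast hjn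
  apply Real.sin_pos_of_pos_of_lt_pi
  · positivity
  · rw [div_lt_iff₀ hn]
    nlinarith [Real.pi_pos]

/-- The sum of `cos (a k π / n)` over `0 ≤ a < n` if `2 n` does not divide `k`. -/
theorem sum_cos_of_not_dvd {n : ℕ} (hn : 0 < n) {k : ℤ} (hk : ¬ (2 * n : ℤ) ∣ k) :
    ∑ a ∈ range n, Real.cos (a * (k * Real.pi / n)) = (1 - (-1 : ℝ) ^ k) / 2 := by
  have hn' : (n : ℝ) ≠ 0 := by positivity
  have h0 : Real.sin (k * Real.pi / n / 2) ≠ 0 := by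
    have := sin_int_mul_pi_div_ne_zero (n := 2 * n) (by omega) (k := k) (by push_cast; exact hk)
    convert this using 2
    push_cast
    field_simp
  have h := two_mul_sin_half_mul_sum_cos (k * Real.pi / n) n
  have h1 : ((n : ℝ) - 1 / 2) * (k * Real.pi / n) = k * Real.pi - k * Real.pi / n / 2 := by
    field_simp
  rw [h1, Real.sin_int_mul_pi_sub] at h
  have h2 : 2 * Real.sin (k * Real.pi / n / 2) *
      ∑ a ∈ range n, Real.cos (a * (k * Real.pi / n)) =
      2 * Real.sin (k * Real.pi / n / 2) * ((1 - (-1 : ℝ) ^ k) / 2) := by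
    rw [h]; ring
  exact mul_left_cancel₀ (mul_ne_zero two_ne_zero h0) h2

theorem sum_cos_of_dvd {n : ℕ} {k : ℤ} (hk : (2 * n : ℤ) ∣ k) :
    ∑ a ∈ range n, Real.cos (a * (k * Real.pi / n)) = n := by
  rcases Nat.eq_zero_or_pos n with rfl | hn
  · simp
  obtain ⟨m, rfl⟩ := hk
  have : ∀ a ∈ range n, Real.cos (a * (((2 * n * m : ℤ) : ℝ) * Real.pi / n)) = 1 := by
    intro a _
    have h : (a * (((2 * n * m : ℤ) : ℝ) * Real.pi / n) : ℝ) = ((a * m : ℤ) : ℝ) * (2 * Real.pi) := by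
      push_cast
      field_simp
    rw [h, Real.cos_int_mul_two_pi]
  rw [sum_congr rfl this]
  simp

/-- Discrete orthogonality of sines. -/
theorem sum_sin_mul_sin {n r s : ℕ} (hr : 0 < r) (hr2 : r < 2 * n) (hs : 0 < s) (hsn : s < n) :
    ∑ j ∈ range (n - 1),
      Real.sin (r * ((j + 1 : ℕ) * Real.pi / n)) * Real.sin (s * ((j + 1 : ℕ) * Real.pi / n)) =
      (n / 2 : ℝ) * ((if r = s then 1 else 0) - (if r + s = 2 * n then 1 else 0)) := by
  have hn : 0 < n := by omega
  obtain ⟨N, rfl⟩ : ∃ N, n = N + 1 := ⟨n - 1, by omega⟩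
  have key : ∀ j : ℕ, Real.sin (r * (j * Real.pi / (N + 1 : ℕ))) *
      Real.sin (s * (j * Real.pi / (N + 1 : ℕ))) =
      (Real.cos (j * (((r - s : ℤ) : ℝ) * Real.pi / (N + 1 : ℕ))) -
        Real.cos (j * (((r + s : ℤ) : ℝ) * Real.pi / (N + 1 : ℕ)))) / 2 := by
    intro j
    have h1 : (j * (((r - s : ℤ) : ℝ) * Real.pi / (N + 1 : ℕ)) : ℝ) =
      r * (j * Real.pi / (N + 1 : ℕ)) - s * (j * Real.pi / (N + 1 : ℕ)) := by push_cast; ring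
    have h2 : (j * (((r + s : ℤ) : ℝ) * Real.pi / (N + 1 : ℕ)) : ℝ) =
      r * (j * Real.pi / (N + 1 : ℕ)) + s * (j * Real.pi / (N + 1 : ℕ)) := by push_cast; ring
    rw [h1, h2, Real.cos_sub, Real.cos_add]
    ring
  -- The term j = 0 vanishes, so it may be added to reach the full range of the cosine sums.
  have h0 : ∑ j ∈ range (N + 1 - 1), Real.sin (r * ((j + 1 : ℕ) * Real.pi / (N + 1 : ℕ))) *
      Real.sin (s * ((j + 1 : ℕ) * Real.pi / (N + 1 : ℕ))) =
      ∑ j ∈ range (N + 1), Real.sin (r * (j * Real.pi / (N + 1 : ℕ))) *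
      Real.sin (s * (j * Real.pi / (N + 1 : ℕ))) := by
    rw [sum_range_succ' _ N]
    simp
  rw [h0, sum_congr rfl (fun j _ => key j), ← sum_div, sum_sub_distrib]
  have hpar : (-1 : ℝ) ^ (r - s : ℤ) = (-1 : ℝ) ^ (r + s : ℤ) := by
    have : (r + s : ℤ) = (r - s) + 2 * s := by ring
    rw [this, zpow_add₀ (by norm_num), zpow_mul]
    simp
  by_cases hrs : r = s
  · subst hrs
    have hne : ¬ (r + r = 2 * (N + 1)) := by omega
    rw [sum_cos_of_dvd (k := (r - r : ℤ)) (by simp), sum_cos_of_not_dvd hn (k := (r + r : ℤ)),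
      ← hpar]
    · simp [hne]
    · rintro ⟨m, hm⟩
      have hm1 : 0 < m := by
        by_contra h
        have : (2 * ((N + 1 : ℕ) : ℤ)) * m ≤ 0 := mul_nonpos_of_nonneg_of_nonpos (by positivity) (by omega)
        omega
      have : (2 * ((N + 1 : ℕ) : ℤ)) * 1 ≤ (2 * ((N + 1 : ℕ) : ℤ)) * m :=
        mul_le_mul_of_nonneg_left (by omega) (by positivity)
      omega
  · have h1 : ¬ ((2 * (N + 1 : ℕ) : ℤ) ∣ (r - s : ℤ)) := by
      intro hd
      have := Int.eq_zero_of_abs_lt_dvd hd (by rw [abs_lt]; constructor <;> push_cast at * <;> omega)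
      omega
    rw [sum_cos_of_not_dvd hn h1, hpar]
    by_cases hadd : r + s = 2 * (N + 1)
    · have h3 : (2 * (N + 1 : ℕ) : ℤ) ∣ (r + s : ℤ) := ⟨1, by push_cast; omega⟩
      rw [sum_cos_of_dvd h3]
      have h4 : (-1 : ℝ) ^ (r + s : ℤ) = 1 := by
        have : (r + s : ℤ) = 2 * (N + 1 : ℕ) := by push_cast; omega
        rw [this, zpow_mul]; simp
      rw [h4, if_neg hrs, if_pos hadd]
      ring
    · have h3 : ¬ ((2 * (N + 1 : ℕ) : ℤ) ∣ (r + s : ℤ)) := by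
        rintro ⟨m, hm⟩
        have hm1 : m = 1 := by
          have h5 : (0:ℤ) < (N + 1 : ℕ) := by positivity
          have : 0 < m := by
            by_contra h
            nlinarith [show (0:ℤ) < r + s by omega]
          have : m < 2 := by
            by_contra h
            have h6 : (r + s : ℤ) < 3 * (N + 1 : ℕ) := by push_cast; omega
            nlinarith
          omega
        subst hm1
        push_cast at hm
        omega
      rw [sum_cos_of_not_dvd hn h3, if_neg hrs, if_neg hadd]
      ring

/-- The Clebsch–Gordan decomposition: after multiplication by sin x the right side telescopes into a
difference of two cosines. -/
theorem sin_mul_sin_eq_sum (p : ℕ) (q x : ℝ) :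
    Real.sin (p * x) * Real.sin (q * x) =
      Real.sin x * ∑ i ∈ range p, Real.sin ((q - p + 1 + 2 * i) * x) := by
  have h : ∀ m : ℕ, Real.sin x * ∑ i ∈ range m, Real.sin ((q - p + 1 + 2 * i) * x) =
      (Real.cos ((q - p) * x) - Real.cos ((q - p + 2 * m) * x)) / 2 := by
    intro m
    induction m with
    | zero => simp
    | succ m ih =>
      rw [sum_range_succ, mul_add, ih]
      have h1 : (q - p + 2 * m : ℝ) * x = (q - p + 1 + 2 * m) * x - x := by ring
      have h2 : (q - p + 2 * (m + 1 : ℕ) : ℝ) * x = (q - p + 1 + 2 * m) * x + x := by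
        push_cast; ring
      rw [h1, h2, Real.cos_sub, Real.cos_add]
      ring
  rw [h p]
  have h1 : (q - p) * x = q * x - p * x := by ring
  have h2 : (q - p + 2 * p) * x = q * x + p * x := by ring
  rw [h1, h2, Real.cos_sub, Real.cos_add]
  ring

/-- The fusion rules of `SU(2)` at level `n - 2` are diagonalised by sines. -/
theorem sum_sin_mul_sin_mul_sin_div {n p q s : ℕ} (hp : 0 < p) (hpn : p < n) (hq : 0 < q)
    (hqn : q < n) (hs : 0 < s) (hsn : s < n) :
    (2 / n : ℝ) * ∑ j ∈ range (n - 1),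
      Real.sin (p * ((j + 1 : ℕ) * Real.pi / n)) * Real.sin (q * ((j + 1 : ℕ) * Real.pi / n)) *
        Real.sin (s * ((j + 1 : ℕ) * Real.pi / n)) / Real.sin ((j + 1 : ℕ) * Real.pi / n) =
      if p < q + s ∧ q < p + s ∧ s < p + q ∧ (p + q + s) % 2 = 1 ∧ p + q + s < 2 * n
        then 1 else 0 := by
  -- The frequencies q - p + 1, q - p + 3, ..., q + p - 1 are natural numbers only in this order.
  wlog hpq : p ≤ q generalizing p q
  · have := this hq hqn hp hpn (by omega)
    have hiff : (p < q + s ∧ q < p + s ∧ s < p + q ∧ (p + q + s) % 2 = 1 ∧ p + q + s < 2 * n) ↔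
        (q < p + s ∧ p < q + s ∧ s < q + p ∧ (q + p + s) % 2 = 1 ∧ q + p + s < 2 * n) := by
      rw [add_comm q p]; tauto
    simp only [hiff]
    rw [← this]
    congr 1
    refine sum_congr rfl fun j _ => ?_
    ring
  have hn : (n : ℝ) ≠ 0 := Nat.cast_ne_zero.2 (by omega)
  have h1 : ∀ j ∈ range (n - 1),
      Real.sin (p * ((j + 1 : ℕ) * Real.pi / n)) * Real.sin (q * ((j + 1 : ℕ) * Real.pi / n)) *
        Real.sin (s * ((j + 1 : ℕ) * Real.pi / n)) / Real.sin ((j + 1 : ℕ) * Real.pi / n) =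
      ∑ i ∈ range p, Real.sin ((q - p + 1 + 2 * i : ℕ) * ((j + 1 : ℕ) * Real.pi / n)) *
        Real.sin (s * ((j + 1 : ℕ) * Real.pi / n)) := by
    intro j hj
    have hj' := mem_range.1 hj
    have := (sin_nat_mul_pi_div_pos (n := n) (j := j + 1) (by omega) (by omega)).ne'
    rw [sin_mul_sin_eq_sum, ← sum_mul]
    have h2 : ∀ i : ℕ, (((q - p + 1 + 2 * i : ℕ)) : ℝ) = q - p + 1 + 2 * i := by
      intro i; push_cast [Nat.cast_sub hpq]; ring
    simp only [h2]
    field_simp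
  rw [sum_congr rfl h1, sum_comm, mul_sum]
  have h3 : ∀ i ∈ range p, (2 / n : ℝ) * ∑ j ∈ range (n - 1),
      Real.sin ((q - p + 1 + 2 * i : ℕ) * ((j + 1 : ℕ) * Real.pi / n)) *
        Real.sin (s * ((j + 1 : ℕ) * Real.pi / n)) =
      (if q - p + 1 + 2 * i = s then 1 else 0) -
        (if q - p + 1 + 2 * i + s = 2 * n then 1 else 0) := by
    intro i hi
    have hi' := mem_range.1 hi
    rw [sum_sin_mul_sin (by omega) (by omega) hs hsn]
    field_simp
  rw [sum_congr rfl h3, sum_sub_distrib]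
  -- Used for m = s and m = 2n - s. The reflected frequency 2n - s occurs exactly when the parity is
  -- right and the perimeter is too large, and then it cancels the occurrence of s.
  have count : ∀ m : ℕ, ∑ i ∈ range p, (if q - p + 1 + 2 * i = m then (1 : ℝ) else 0) =
      if q < p + m ∧ m < p + q ∧ (p + q + m) % 2 = 1 then 1 else 0 := by
    intro m
    by_cases h : q < p + m ∧ m < p + q ∧ (p + q + m) % 2 = 1
    · rw [if_pos h, sum_eq_single ((m + p - q - 1) / 2)]
      · rw [if_pos (by omega)]
      · intro b _ hb
        rw [if_neg (by omega)]
      · intro hb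
        rw [mem_range] at hb
        omega
    · rw [if_neg h]
      refine sum_eq_zero fun i hi => ?_
      have hi' := mem_range.1 hi
      rw [if_neg (by omega)]
  have h4 : ∀ i ∈ range p, (if q - p + 1 + 2 * i + s = 2 * n then (1 : ℝ) else 0) =
      if q - p + 1 + 2 * i = 2 * n - s then 1 else 0 := by
    intro i _
    congr 1
    rw [eq_iff_iff]
    omega
  rw [sum_congr rfl h4, count, count]
  split_ifs <;> first | (norm_num; done) | (exfalso; omega)

/-- Folding a sum over `1 ≤ j ≤ 2 s + 1` that is symmetric under `j ↦ 2 s + 2 - j`. -/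
theorem sum_range_fold_even {s : ℕ} {G : ℕ → ℝ} (hG : ∀ j < s, G (2 * s - j) = G j) :
    ∑ j ∈ range (2 * s + 1), G j = 2 * ∑ j ∈ range s, G j + G s := by
  have h1 : ∑ j ∈ range (2 * s + 1), G j = ∑ j ∈ range s, G j + ∑ j ∈ range (s + 1), G (s + j) := by
    rw [← sum_range_add]; congr 2; omega
  have h2 : ∑ j ∈ range (s + 1), G (s + j) = ∑ j ∈ range s, G j + G s := by
    rw [← sum_range_reflect, sum_range_succ]
    congr 1
    · refine sum_congr rfl fun j hj => ?_
      have hj' := mem_range.1 hj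
      rw [← hG j hj']
      congr 1; omega
    · congr 1; omega
  rw [h1, h2]; ring

/-- Folding a sum over `1 ≤ j ≤ 2 s` that is symmetric under `j ↦ 2 s + 1 - j` onto
the even indices. -/
theorem sum_range_fold_odd {s : ℕ} {G : ℕ → ℝ} (hG : ∀ j < s, G (2 * s - 2 * j - 2) = G (2 * j + 1)) :
    ∑ j ∈ range (2 * s), G j = 2 * ∑ j ∈ range s, G (2 * j + 1) := by
  have h1 : ∀ m, ∑ j ∈ range (2 * m), G j =
      ∑ j ∈ range m, G (2 * j + 1) + ∑ j ∈ range m, G (2 * j) := by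
    intro m
    induction m with
    | zero => simp
    | succ m ih =>
      rw [show 2 * (m + 1) = 2 * m + 1 + 1 by ring, sum_range_succ, sum_range_succ, ih,
        sum_range_succ, sum_range_succ]
      ring
  rw [h1, two_mul]
  congr 1
  rw [← sum_range_reflect]
  refine sum_congr rfl fun j hj => ?_
  have hj' := mem_range.1 hj
  rw [← hG j hj']
  congr 1; omega

/-! ### Sums of even powers of cosecants -/

/-- The sum of `sin (j π / n) ^ (-2 m)` over `1 ≤ j < n`. -/
noncomputable def cscSum (m n : ℕ) : ℝ :=
  ∑ j ∈ range (n - 1), ((Real.sin ((j + 1 : ℕ) * Real.pi / n) ^ 2)⁻¹) ^ m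

/-- The sum `cscSum` twisted by `cos (2 a j π / n)`. -/
noncomputable def cscCosSum (m n a : ℕ) : ℝ :=
  ∑ j ∈ range (n - 1), Real.cos (2 * a * ((j + 1 : ℕ) * Real.pi / n)) *
    ((Real.sin ((j + 1 : ℕ) * Real.pi / n) ^ 2)⁻¹) ^ m

/-- The product of `x ^ 2 - i ^ 2` over `1 ≤ i ≤ k`. -/
noncomputable def centralProd (k : ℕ) (x : ℝ) : ℝ := ∏ i ∈ range k, (x ^ 2 - (i + 1) ^ 2)

theorem centralProd_succ (k : ℕ) (x : ℝ) :
    centralProd (k + 1) x = centralProd k x * (x ^ 2 - (k + 1) ^ 2) := prod_range_succ _ _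

/-- The polynomial x · `centralProd k x` is the product of x + i over |i| ≤ k. The window of radius
k + 1 about x + 1 is the window of radius k about x with two more factors at its upper end. -/
theorem mul_centralProd_add_one (k : ℕ) (x : ℝ) :
    (x + 1) * centralProd (k + 1) (x + 1) =
      x * centralProd k x * ((x + k + 1) * (x + k + 2)) := by
  induction k with
  | zero => simp [centralProd]; ring
  | succ k ih =>
    rw [centralProd_succ, ← mul_assoc, ih, centralProd_succ]
    push_cast
    ring

theorem centralProd_neg (k : ℕ) (x : ℝ) : centralProd k (-x) = centralProd k x := by
  simp [centralProd]

theorem mul_centralProd_sub_one (k : ℕ) (x : ℝ) :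
    (x - 1) * centralProd (k + 1) (x - 1) =
      x * centralProd k x * ((x - k - 1) * (x - k - 2)) := by
  have h := mul_centralProd_add_one k (-x)
  rw [show -x + 1 = -(x - 1) by ring, centralProd_neg, centralProd_neg] at h
  linear_combination -h

/-- Even polynomials, each the second central difference of the next. -/
noncomputable def evenCentral : ℕ → ℝ → ℝ
  | 0, _ => 1
  | k + 1, x => x ^ 2 * centralProd k x / (2 * k + 2).factorial

/-- Odd polynomials, each the second central difference of the next. -/
noncomputable def oddCentral (k : ℕ) (x : ℝ) : ℝ := x * centralProd k x / (2 * k + 1).factorial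

theorem evenCentral_second_diff (k : ℕ) (x : ℝ) :
    evenCentral (k + 1) (x + 1) + evenCentral (k + 1) (x - 1) - 2 * evenCentral (k + 1) x =
      evenCentral k x := by
  cases k with
  | zero => simp [evenCentral, centralProd]; ring
  | succ k =>
    have h1 := mul_centralProd_add_one k x
    have h2 := mul_centralProd_sub_one k x
    have h3 := centralProd_succ k x
    have hf : ((2 * (k + 1) + 2).factorial : ℝ) =
        (2 * k + 4) * (2 * k + 3) * (2 * k + 2).factorial := by
      rw [show 2 * (k + 1) + 2 = (2 * k + 2) + 1 + 1 by ring, Nat.factorial_succ,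
        Nat.factorial_succ]
      push_cast; ring
    have hf0 : ((2 * k + 2).factorial : ℝ) ≠ 0 := by positivity
    simp only [evenCentral]
    rw [hf]
    field_simp
    rw [h3]
    linear_combination (x + 1) * h1 + (x - 1) * h2

theorem oddCentral_second_diff (k : ℕ) (x : ℝ) :
    oddCentral (k + 1) (x + 1) + oddCentral (k + 1) (x - 1) - 2 * oddCentral (k + 1) x =
      oddCentral k x := by
  have h1 := mul_centralProd_add_one k x
  have h2 := mul_centralProd_sub_one k x
  have h3 := centralProd_succ k x
  have hf : ((2 * (k + 1) + 1).factorial : ℝ) =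
      (2 * k + 3) * (2 * k + 2) * (2 * k + 1).factorial := by
    rw [show 2 * (k + 1) + 1 = (2 * k + 1) + 1 + 1 by ring, Nat.factorial_succ,
      Nat.factorial_succ]
    push_cast; ring
  have hf0 : ((2 * k + 1).factorial : ℝ) ≠ 0 := by positivity
  simp only [oddCentral]
  rw [hf]
  field_simp
  rw [h3]
  linear_combination h1 + h2

/-- The numbers `cscSum m n` with the value at `m = 0` replaced by `-1`. -/
noncomputable def cscCoeff (n : ℕ) : ℕ → ℝ
  | 0 => -1
  | m + 1 => cscSum (m + 1) n

/-- The odd part of `cscCosSum m n` as a function of `a`. -/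
noncomputable def cscOddPart (n : ℕ) : ℕ → ℝ → ℝ
  | 0, _ => 0
  | m + 1, x => -2 * n * (-4) ^ m * oddCentral m x

theorem cscOddPart_second_diff (n m : ℕ) (x : ℝ) :
    cscOddPart n (m + 1) (x + 1) + cscOddPart n (m + 1) (x - 1) - 2 * cscOddPart n (m + 1) x =
      -4 * cscOddPart n m x := by
  cases m with
  | zero => simp [cscOddPart, oddCentral, centralProd]; ring
  | succ m =>
    simp only [cscOddPart]
    rw [← oddCentral_second_diff m x]
    ring

/-- The polynomial in `a` that agrees with `cscCosSum m n a` for `0 < a < n`. -/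
noncomputable def cscPoly (n m : ℕ) (x : ℝ) : ℝ :=
  ∑ k ∈ range (m + 1), (-4) ^ k * evenCentral k x * cscCoeff n (m - k) + cscOddPart n m x

theorem cscPoly_second_diff (n m : ℕ) (x : ℝ) :
    cscPoly n (m + 1) (x + 1) + cscPoly n (m + 1) (x - 1) - 2 * cscPoly n (m + 1) x =
      -4 * cscPoly n m x := by
  have h : ∑ k ∈ range (m + 1), (-4 : ℝ) ^ (k + 1) * evenCentral (k + 1) (x + 1) *
        cscCoeff n (m + 1 - (k + 1)) +
      ∑ k ∈ range (m + 1), (-4 : ℝ) ^ (k + 1) * evenCentral (k + 1) (x - 1) *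
        cscCoeff n (m + 1 - (k + 1)) -
      2 * ∑ k ∈ range (m + 1), (-4 : ℝ) ^ (k + 1) * evenCentral (k + 1) x *
        cscCoeff n (m + 1 - (k + 1)) =
      -4 * ∑ k ∈ range (m + 1), (-4 : ℝ) ^ k * evenCentral k x * cscCoeff n (m - k) := by
    rw [mul_sum, mul_sum, ← sum_add_distrib, ← sum_sub_distrib]
    refine sum_congr rfl fun k _ => ?_
    rw [← evenCentral_second_diff k x, Nat.add_sub_add_right]
    ring
  have h' := cscOddPart_second_diff n m x
  simp only [cscPoly]
  rw [sum_range_succ' _ (m + 1), sum_range_succ' _ (m + 1), sum_range_succ' _ (m + 1)]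
  simp only [evenCentral] at h ⊢
  linear_combination h + h'

/-- The second difference of cos(2ay) in a is -4 sin²y cos(2ay), which cancels one power of the
cosecant. -/
theorem cscCosSum_second_diff {n : ℕ} (m a : ℕ) :
    cscCosSum (m + 1) n (a + 2) + cscCosSum (m + 1) n a - 2 * cscCosSum (m + 1) n (a + 1) =
      -4 * cscCosSum m n (a + 1) := by
  simp only [cscCosSum]
  rw [mul_sum, mul_sum, ← sum_add_distrib, ← sum_sub_distrib]
  refine sum_congr rfl fun j hj => ?_
  have hj' := mem_range.1 hj
  have hs := (sin_nat_mul_pi_div_pos (n := n) (j := j + 1) (by omega) (by omega)).ne'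
  set y := ((j + 1 : ℕ) * Real.pi / n : ℝ)
  have h1 : 2 * ((a + 2 : ℕ) : ℝ) * y = 2 * (a + 1 : ℕ) * y + 2 * y := by push_cast; ring
  have h2 : 2 * (a : ℝ) * y = 2 * (a + 1 : ℕ) * y - 2 * y := by push_cast; ring
  rw [h1, h2, Real.cos_add, Real.cos_sub, Real.cos_two_mul, Real.cos_sq', pow_succ]
  have hmul := mul_inv_cancel₀ (pow_ne_zero 2 hs)
  linear_combination
    (-4 * Real.cos (2 * (a + 1 : ℕ) * y) * ((Real.sin y ^ 2)⁻¹) ^ m) * hmul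

theorem cscCosSum_zero_right (m n : ℕ) : cscCosSum m n 0 = cscSum m n := by
  simp [cscCosSum, cscSum]

theorem cscCosSum_self {n : ℕ} (hn : 0 < n) (m : ℕ) : cscCosSum m n n = cscSum m n := by
  have hn' : (n : ℝ) ≠ 0 := by positivity
  simp only [cscCosSum, cscSum]
  refine sum_congr rfl fun j _ => ?_
  have : (2 * n * ((j + 1 : ℕ) * Real.pi / n) : ℝ) = (j + 1 : ℕ) * (2 * Real.pi) := by
    field_simp
  rw [this, Real.cos_nat_mul_two_pi, one_mul]

theorem cscCosSum_one (m n : ℕ) :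
    cscCosSum (m + 1) n 1 = cscSum (m + 1) n - 2 * cscSum m n := by
  simp only [cscCosSum, cscSum]
  rw [mul_sum, ← sum_sub_distrib]
  refine sum_congr rfl fun j hj => ?_
  have hj' := mem_range.1 hj
  have hs := (sin_nat_mul_pi_div_pos (n := n) (j := j + 1) (by omega) (by omega)).ne'
  set y := ((j + 1 : ℕ) * Real.pi / n : ℝ)
  rw [Nat.cast_one, mul_one, Real.cos_two_mul, Real.cos_sq', pow_succ]
  have hmul := mul_inv_cancel₀ (pow_ne_zero 2 hs)
  linear_combination (-2 * ((Real.sin y ^ 2)⁻¹) ^ m) * hmul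

theorem cscCosSum_zero_left {n a : ℕ} (ha : 0 < a) (han : a < n) : cscCosSum 0 n a = -1 := by
  obtain ⟨N, rfl⟩ : ∃ N, n = N + 1 := ⟨n - 1, by omega⟩
  have h := sum_cos_of_not_dvd (n := N + 1) (by omega) (k := 2 * a) (by
    rw [Int.mul_dvd_mul_iff_left (by norm_num)]
    intro h
    have := Int.le_of_dvd (by omega) h
    omega)
  rw [sum_range_succ', zpow_mul] at h
  simp only [cscCosSum, pow_zero, mul_one, Nat.add_sub_cancel]
  have h2 : ∑ j ∈ range N, Real.cos (2 * a * ((j + 1 : ℕ) * Real.pi / (N + 1 : ℕ))) =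
      ∑ j ∈ range N, Real.cos ((j + 1 : ℕ) * (((2 * a : ℤ) : ℝ) * Real.pi / (N + 1 : ℕ))) := by
    refine sum_congr rfl fun j _ => ?_
    congr 1
    push_cast
    ring
  rw [h2]
  simp at h
  push_cast
  linarith

theorem centralProd_succ_one (k : ℕ) : centralProd (k + 1) 1 = 0 := by
  rw [centralProd, prod_range_succ']
  simp

theorem cscPoly_succ_zero (n m : ℕ) : cscPoly n (m + 1) 0 = cscSum (m + 1) n := by
  rw [cscPoly, sum_range_succ']
  simp [cscOddPart, oddCentral, evenCentral, cscCoeff]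

theorem cscPoly_succ_one {n : ℕ} (hn : 0 < n) (m : ℕ) :
    cscPoly n (m + 1) 1 = cscSum (m + 1) n - 2 * cscSum m n := by
  rw [cscPoly, sum_range_succ', sum_range_succ']
  have h0 : ∑ k ∈ range m, (-4 : ℝ) ^ (k + 1 + 1) * evenCentral (k + 1 + 1) 1 *
      cscCoeff n (m + 1 - (k + 1 + 1)) = 0 :=
    sum_eq_zero fun k _ => by simp [evenCentral, centralProd_succ_one]
  rw [h0]
  cases m with
  | zero =>
    simp [evenCentral, cscOddPart, oddCentral, centralProd, cscCoeff, cscSum,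
      Nat.cast_sub (Nat.one_le_iff_ne_zero.2 hn.ne')]
    ring
  | succ m =>
    simp [evenCentral, cscOddPart, oddCentral, centralProd_succ_one, cscCoeff]
    simp [centralProd]
    ring

/-- Both sides have the same second difference in a, namely -4 times the previous level, and the
same values at a = 0 and a = 1. At level 0 the sum is n - 1 for a = 0 and a = n, whereas the
polynomial is -1; the recurrence only consults interior arguments of the previous level. -/
theorem cscCosSum_eq_cscPoly {n : ℕ} (hn : 0 < n) (m : ℕ) :
    ∀ a : ℕ, (0 < a ∧ a < n) ∨ (a ≤ n ∧ m ≠ 0) → cscCosSum m n a = cscPoly n m a := by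
  induction m with
  | zero =>
    rintro a (⟨ha, han⟩ | ⟨-, h⟩)
    · rw [cscCosSum_zero_left ha han]
      simp [cscPoly, evenCentral, cscCoeff, cscOddPart]
    · exact absurd rfl h
  | succ m ih =>
    intro a ha
    replace ha : a ≤ n := by omega
    induction a using Nat.strong_induction_on with
    | _ a iha =>
      match a, ha, iha with
      | 0, _, _ => rw [cscCosSum_zero_right, Nat.cast_zero, cscPoly_succ_zero]
      | 1, _, _ => rw [cscCosSum_one, Nat.cast_one, cscPoly_succ_one hn]
      | a + 2, ha, iha =>
        have h1 := cscCosSum_second_diff (n := n) m a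
        have h2 := cscPoly_second_diff n m (a + 1 : ℕ)
        rw [iha a (by omega) (by omega), iha (a + 1) (by omega) (by omega),
          ih (a + 1) (Or.inl ⟨by omega, by omega⟩)] at h1
        rw [show ((a + 1 : ℕ) : ℝ) + 1 = (a + 2 : ℕ) by push_cast; ring,
          show ((a + 1 : ℕ) : ℝ) - 1 = a by push_cast; ring] at h2
        linarith

/-- Newton's recursion for the sums of powers of cosecants. -/
theorem cscSum_succ {n : ℕ} (hn : 0 < n) (m : ℕ) :
    cscSum (m + 1) n = 1 / 2 * (∑ k ∈ range (m + 1), (-4) ^ (k + 2) *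
      (centralProd (k + 1) n / (2 * (k + 1) + 2).factorial) * cscCoeff n (m - k) -
        2 * (-4) ^ (m + 1) * (centralProd (m + 1) n / (2 * (m + 1) + 1).factorial)) := by
  -- At a = n the twist disappears, so the top sum `cscSum (m + 2) n` cancels. All other terms
  -- contain n², and dividing by it leaves an equation for `cscSum (m + 1) n`.
  have h := cscCosSum_eq_cscPoly hn (m + 2) n (Or.inr ⟨le_rfl, by omega⟩)
  rw [cscCosSum_self hn, cscPoly, sum_range_succ', sum_range_succ'] at h
  have hn' : (n : ℝ) ^ 2 ≠ 0 := by positivity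
  have h1 : ∑ k ∈ range (m + 1), (-4 : ℝ) ^ (k + 1 + 1) * evenCentral (k + 1 + 1) n *
      cscCoeff n (m + 2 - (k + 1 + 1)) = n ^ 2 * ∑ k ∈ range (m + 1), (-4) ^ (k + 2) *
      (centralProd (k + 1) n / (2 * (k + 1) + 2).factorial) * cscCoeff n (m - k) := by
    rw [mul_sum]
    refine sum_congr rfl fun k _ => ?_
    simp only [evenCentral]
    rw [show m + 2 - (k + 1 + 1) = m - k by omega]
    ring
  have h2 : cscOddPart n (m + 2) n = n ^ 2 *
      (-2 * (-4) ^ (m + 1) * (centralProd (m + 1) n / (2 * (m + 1) + 1).factorial)) := by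
    simp only [cscOddPart, oddCentral]
    ring
  have h3 : (-4 : ℝ) ^ (0 + 1) * evenCentral (0 + 1) n * cscCoeff n (m + 2 - (0 + 1)) =
      n ^ 2 * (-2 * cscSum (m + 1) n) := by
    simp [evenCentral, centralProd, cscCoeff]
    ring
  have h4 : (-4 : ℝ) ^ 0 * evenCentral 0 n * cscCoeff n (m + 2 - 0) = cscSum (m + 2) n := by
    simp [evenCentral, cscCoeff]
  rw [h1, h2, h3, h4] at h
  have h5 : (n : ℝ) ^ 2 * (∑ k ∈ range (m + 1), (-4) ^ (k + 2) *
      (centralProd (k + 1) n / (2 * (k + 1) + 2).factorial) * cscCoeff n (m - k) -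
        2 * (-4) ^ (m + 1) * (centralProd (m + 1) n / (2 * (m + 1) + 1).factorial) -
        2 * cscSum (m + 1) n) = 0 := by
    linear_combination -h
  have h6 := (mul_eq_zero.1 h5).resolve_left hn'
  linarith

/-- Sums of even powers of cosecants are polynomial in the number of subdivisions. -/
theorem exists_polynomial_cscSum (m : ℕ) :
    ∃ p : Polynomial ℝ, ∀ n : ℕ, 0 < n → cscSum m n = p.eval (n : ℝ) := by
  have key : ∀ m, ∃ p : Polynomial ℝ, ∀ n : ℕ, 0 < n → cscCoeff n m = p.eval (n : ℝ) := by
    intro m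
    induction m using Nat.strong_induction_on with
    | _ m ih =>
      cases m with
      | zero => exact ⟨Polynomial.C (-1), fun n _ => by simp [cscCoeff]⟩
      | succ m =>
        choose! p hp using ih
        let c : ℕ → Polynomial ℝ := fun k =>
          ∏ i ∈ range k, (Polynomial.X ^ 2 - Polynomial.C (((i : ℝ) + 1) ^ 2))
        have hc : ∀ k (x : ℝ), (c k).eval x = centralProd k x := by
          intro k x
          simp only [c, centralProd, Polynomial.eval_prod, Polynomial.eval_sub,
            Polynomial.eval_pow, Polynomial.eval_X, Polynomial.eval_C]
        refine ⟨Polynomial.C (1 / 2) * (∑ k ∈ range (m + 1), Polynomial.C ((-4) ^ (k + 2)) *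
          (c (k + 1) * Polynomial.C (((2 * (k + 1) + 2).factorial : ℝ)⁻¹)) * p (m - k) -
          Polynomial.C (2 * (-4) ^ (m + 1)) *
            (c (m + 1) * Polynomial.C (((2 * (m + 1) + 1).factorial : ℝ)⁻¹))), fun n hn => ?_⟩
        simp only [cscCoeff]
        rw [cscSum_succ hn]
        simp only [Polynomial.eval_mul, Polynomial.eval_sub, Polynomial.eval_C,
          Polynomial.eval_finsetSum, hc, div_eq_mul_inv]
        congr 2
        refine sum_congr rfl fun k _ => ?_
        rw [hp (m - k) (by omega) n hn]
  cases m with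
  | zero =>
    refine ⟨Polynomial.X - 1, fun n hn => ?_⟩
    simp [cscSum, Nat.cast_sub (Nat.one_le_iff_ne_zero.2 hn.ne')]
  | succ m => exact key (m + 1)

/-! ### State sums on trivalent networks -/

open Classical in
/-- A finite connected network with nodes `I`, each meeting three edges. The edges in `internal`
have the two ends `src e` and `tgt e` in `I`; the others have the one end `src e` in `I`.
The incidence multiplicities are recorded by `mult`. -/
structure TrivalentNet (I E : Type*) [Fintype I] [Fintype E] where
  mult : I → E → ℕ
  internal : Finset E
  src : E → I
  tgt : E → I
  prod_internal : ∀ e ∈ internal, ∀ f : I → ℝ, ∏ v, f v ^ mult v e = f (src e) * f (tgt e)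
  prod_leaf : ∀ e ∉ internal, ∀ f : I → ℝ, ∏ v, f v ^ mult v e = f (src e)
  exists_triple : ∀ v, ∃ a b c : E, ∀ e, (if e = a then 1 else 0) + (if e = b then 1 else 0) +
    (if e = c then 1 else 0) = mult v e
  connected : ∀ P : I → Prop, (∀ e ∈ internal, P (src e) ↔ P (tgt e)) → ∀ u v, P u → P v

namespace TrivalentNet

variable {I E : Type*} [Fintype I] [Fintype E] (N : TrivalentNet I E)

open Classical in
/-- `a, b, c` are the three edges at `v`. -/
def IsTriple (v : I) (a b c : E) : Prop :=
  ∀ e, (if e = a then 1 else 0) + (if e = b then 1 else 0) + (if e = c then 1 else 0) = N.mult v e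

variable {N}

theorem IsTriple.prod_eq {v : I} {a b c : E} (h : N.IsTriple v a b c) (f : E → ℝ) :
    ∏ e, f e ^ N.mult v e = f a * f b * f c := by
  classical
  have h' : ∀ e, f e ^ N.mult v e = (if e = a then f e else 1) * (if e = b then f e else 1) *
      (if e = c then f e else 1) := by
    intro e
    rw [← h e, pow_add, pow_add]
    congr 1
    · congr 1 <;> split_ifs <;> simp
    · split_ifs <;> simp
  simp only [h', prod_mul_distrib, prod_ite_eq', mem_univ, if_true]

variable (N)

/-- Test the product formula on the function that is 0 at `src e` and 1 elsewhere: the right side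
vanishes, so the exponent at `src e` cannot be 0. -/
theorem mult_src_ne_zero (e : E) : N.mult (N.src e) e ≠ 0 := by
  classical
  intro h0
  have key : ∏ v, (if v = N.src e then (0 : ℝ) else 1) ^ N.mult v e = 1 := by
    refine prod_eq_one fun v _ => ?_
    split_ifs with h
    · rw [h, h0, pow_zero]
    · simp
  by_cases he : e ∈ N.internal
  · rw [N.prod_internal e he (fun v => if v = N.src e then (0 : ℝ) else 1)] at key
    simp at key
  · rw [N.prod_leaf e he (fun v => if v = N.src e then (0 : ℝ) else 1)] at key
    simp at key

theorem exists_isTriple_mem (e : E) :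
    ∃ v a b c, N.IsTriple v a b c ∧ (e = a ∨ e = b ∨ e = c) := by
  obtain ⟨a, b, c, h⟩ := N.exists_triple (N.src e)
  refine ⟨N.src e, a, b, c, h, ?_⟩
  have h1 := h e
  have h2 := N.mult_src_ne_zero e
  by_contra! hne
  simp [hne] at h1
  omega

/-- The handshake identity. -/
theorem three_mul_card :
    3 * Fintype.card I = 2 * #N.internal + (Fintype.card E - #N.internal) := by
  classical
  -- The exponent of 2 counts edge ends, by nodes here and by edges in `h2`.
  have h1 : ∏ v : I, ∏ e : E, (2 : ℝ) ^ N.mult v e = 2 ^ (3 * Fintype.card I) := by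
    have : ∀ v ∈ (univ : Finset I), ∏ e : E, (2 : ℝ) ^ N.mult v e = 2 ^ 3 := by
      intro v _
      obtain ⟨a, b, c, h⟩ := N.exists_triple v
      rw [IsTriple.prod_eq (N := N) h (fun _ => 2)]
      norm_num
    rw [prod_congr rfl this, prod_const, card_univ, ← pow_mul]
  have h2 : ∏ e : E, ∏ v : I, (2 : ℝ) ^ N.mult v e =
      2 ^ (2 * #N.internal + (Fintype.card E - #N.internal)) := by
    rw [← prod_mul_prod_compl N.internal]
    have h3 : ∀ e ∈ N.internal, ∏ v : I, (2 : ℝ) ^ N.mult v e = 2 ^ 2 := by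
      intro e he
      rw [N.prod_internal e he (fun _ => 2)]; norm_num
    have h4 : ∀ e ∈ N.internalᶜ, ∏ v : I, (2 : ℝ) ^ N.mult v e = 2 := by
      intro e he
      rw [N.prod_leaf e (mem_compl.1 he) (fun _ => 2)]
    rw [prod_congr rfl h3, prod_congr rfl h4, prod_const, prod_const, ← pow_mul, ← pow_add,
      card_compl]
  rw [prod_comm, h2] at h1
  have := Nat.pow_right_injective (le_refl 2) (a₁ := 2 * #N.internal + (Fintype.card E - #N.internal))
    (a₂ := 3 * Fintype.card I) (by exact_mod_cast h1)
  exact this.symm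

/-- The state sum of a connected trivalent network for orthogonal characters `χ`
with square norms `ω`. -/
theorem state_sum [DecidableEq E] [Nonempty I] {A J : Type*} [Fintype A] [Fintype J] [DecidableEq J]
    (χ : J → A → ℝ) (ω : J → ℝ)
    (horth : ∀ i j, ∑ a, χ i a * χ j a = if i = j then ω i else 0) :
    ∑ w : E → A, ∏ v, ∑ j, (ω j)⁻¹ * ∏ e, χ j (w e) ^ N.mult v e =
      ∑ j, ω j ^ #N.internal * (∑ a, χ j a) ^ (Fintype.card E - #N.internal) *
        ((ω j)⁻¹) ^ Fintype.card I := by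
  classical
  -- Expanding the product over the nodes chooses an index `p v` at every node.
  have h1 : ∀ w : E → A, ∏ v, ∑ j, (ω j)⁻¹ * ∏ e, χ j (w e) ^ N.mult v e =
      ∑ p : I → J, (∏ v, (ω (p v))⁻¹) * ∏ e, ∏ v, χ (p v) (w e) ^ N.mult v e := by
    intro w
    rw [Fintype.prod_sum]
    refine sum_congr rfl fun p _ => ?_
    rw [prod_mul_distrib, prod_comm (s := univ (α := I)) (t := univ (α := E))]
  rw [sum_congr rfl (fun w _ => h1 w), sum_comm]
  -- For fixed `p` the labels of different edges are independent; orthogonality along an internal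
  -- edge compares the indices at its two ends.
  have h2 : ∀ p : I → J, ∑ w : E → A, (∏ v, (ω (p v))⁻¹) *
      ∏ e, ∏ v, χ (p v) (w e) ^ N.mult v e =
      (∏ v, (ω (p v))⁻¹) * ((∏ e ∈ N.internal,
        if p (N.src e) = p (N.tgt e) then ω (p (N.src e)) else 0) *
        ∏ e ∈ N.internalᶜ, ∑ a, χ (p (N.src e)) a) := by
    intro p
    rw [← mul_sum]
    congr 1
    rw [← Fintype.prod_sum (f := fun e a => ∏ v, χ (p v) a ^ N.mult v e),
      ← prod_mul_prod_compl N.internal]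
    congr 1
    · refine prod_congr rfl fun e he => ?_
      rw [← horth]
      exact sum_congr rfl fun a _ => N.prod_internal e he (fun v => χ (p v) a)
    · refine prod_congr rfl fun e he => ?_
      exact sum_congr rfl fun a _ => N.prod_leaf e (mem_compl.1 he) (fun v => χ (p v) a)
  rw [sum_congr rfl (fun p _ => h2 p)]
  symm
  -- By connectedness only the constant `p` contribute.
  refine sum_of_injOn (fun j _ => j) ?_ (fun _ _ => by simp) ?_ ?_
  · intro j _ j' _ h
    exact congrFun h (Classical.arbitrary I)
  · intro p _ hp
    have : ∃ e ∈ N.internal, p (N.src e) ≠ p (N.tgt e) := by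
      by_contra! hall
      apply hp
      refine ⟨p (Classical.arbitrary I), by simp, ?_⟩
      funext v
      exact (N.connected (fun x => p x = p (Classical.arbitrary I))
        (fun e he => by rw [hall e he]) (Classical.arbitrary I) v rfl).symm
    obtain ⟨e, he, hne⟩ := this
    rw [prod_eq_zero he (by rw [if_neg hne])]
    simp
  · intro j _
    simp only [if_true, prod_const, card_univ, card_compl]
    ring

/-- The number of integer labelings of the edges subject to a local condition at every node
that is diagonalised by orthogonal characters. -/
theorem ncard_labelings [Nonempty I] {J : Type*} [Fintype J] [DecidableEq J] {M : ℕ}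
    (R : ℤ → ℤ → ℤ → Prop) [∀ a b c, Decidable (R a b c)]
    (χ : J → Fin M → ℝ) (ω : J → ℝ)
    (horth : ∀ i j, ∑ a, χ i a * χ j a = if i = j then ω i else 0)
    (hR : ∀ a b c : Fin M, (if R (a : ℕ) (b : ℕ) (c : ℕ) then (1 : ℝ) else 0) =
      ∑ j, (ω j)⁻¹ * (χ j a * χ j b * χ j c))
    (hbound : ∀ a b c, R a b c → (0 ≤ a ∧ a < M) ∧ (0 ≤ b ∧ b < M) ∧ (0 ≤ c ∧ c < M)) :
    ({z : E → ℤ | ∀ v a b c, N.IsTriple v a b c → R (z a) (z b) (z c)}.ncard : ℝ) =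
      ∑ j, ω j ^ #N.internal * (∑ a, χ j a) ^ (Fintype.card E - #N.internal) *
        ((ω j)⁻¹) ^ Fintype.card I := by
  classical
  rw [← N.state_sum χ ω horth]
  let S : Finset (E → Fin M) := univ.filter fun w =>
    ∀ v a b c, N.IsTriple v a b c → R ((w a : ℕ) : ℤ) ((w b : ℕ) : ℤ) ((w c : ℕ) : ℤ)
  let φ : (E → Fin M) → E → ℤ := fun w e => ((w e : ℕ) : ℤ)
  have hφ : Function.Injective φ := by
    intro w w' h
    funext e
    have := congrFun h e
    simp only [φ] at this
    exact Fin.ext (by exact_mod_cast this)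
  have himg : {z : E → ℤ | ∀ v a b c, N.IsTriple v a b c → R (z a) (z b) (z c)} =
      φ '' (S : Set (E → Fin M)) := by
    ext z
    simp only [Set.mem_ofPred_eq, Set.mem_image, S, coe_filter, mem_univ, true_and]
    constructor
    · intro hz
      have hz' : ∀ e, 0 ≤ z e ∧ z e < M := by
        intro e
        obtain ⟨v, a, b, c, h, he⟩ := N.exists_isTriple_mem e
        have := hbound _ _ _ (hz v a b c h)
        rcases he with rfl | rfl | rfl
        exacts [this.1, this.2.1, this.2.2]
      have hval : ∀ e, (((z e).toNat : ℕ) : ℤ) = z e := fun e => Int.toNat_of_nonneg (hz' e).1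
      refine ⟨fun e => ⟨(z e).toNat, by have := hz' e; omega⟩, ?_, funext hval⟩
      intro v a b c h
      simp only [hval]
      exact hz v a b c h
    · rintro ⟨w, hw, rfl⟩
      exact hw
  rw [himg, Set.ncard_image_of_injective _ hφ, Set.ncard_coe_finset, card_filter, Nat.cast_sum]
  refine sum_congr rfl fun w _ => ?_
  have hloc : ∀ v a b c, N.IsTriple v a b c → ∑ j, (ω j)⁻¹ * ∏ e, χ j (w e) ^ N.mult v e =
      if R ((w a : ℕ) : ℤ) ((w b : ℕ) : ℤ) ((w c : ℕ) : ℤ) then 1 else 0 := by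
    intro v a b c h
    rw [hR]
    exact sum_congr rfl fun j _ => by rw [h.prod_eq (fun e => χ j (w e))]
  split_ifs with hw
  · rw [prod_eq_one, Nat.cast_one]
    intro v _
    obtain ⟨a, b, c, h⟩ := N.exists_triple v
    rw [hloc v a b c h, if_pos (hw v a b c h)]
  · push Not at hw
    obtain ⟨v, a, b, c, h, hn⟩ := hw
    rw [prod_eq_zero (mem_univ v) (by rw [hloc v a b c h, if_neg hn]), Nat.cast_zero]

end TrivalentNet

/-! ### The trivalent network of a connected graph with degrees 1 and 3 -/

namespace Graph

variable {α β : Type*} {G : Graph α β}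

open Classical in
/-- The number of ends of the edge `e` at the vertex `v`. -/
noncomputable def incMult (G : Graph α β) (v : α) (e : β) : ℕ :=
  (if G.Inc e v then 1 else 0) + (if G.IsLoopAt e v then 1 else 0)

open Classical in
theorem IsLink.incMult_eq {e : β} {x y : α} (h : G.IsLink e x y) (v : α) :
    G.incMult v e = (if v = x then 1 else 0) + (if v = y then 1 else 0) := by
  have h1 : G.Inc e v ↔ v = x ∨ v = y :=
    ⟨fun hv => hv.eq_or_eq_of_isLink h, by rintro (rfl | rfl); exacts [h.inc_left, h.inc_right]⟩
  have h2 : G.IsLoopAt e v ↔ v = x ∧ v = y := by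
    constructor
    · intro hv
      exact ⟨hv.eq_of_inc h.inc_left, hv.eq_of_inc h.inc_right⟩
    · rintro ⟨rfl, hy⟩
      rw [← hy] at h
      exact h
  unfold incMult
  simp only [h1, h2]
  split_ifs <;> first | rfl | (exfalso; tauto)

open Classical in
theorem ncard_eq_sum_edges [Fintype E(G)] (p : β → Prop) (hp : ∀ e, p e → e ∈ E(G)) :
    {e | p e}.ncard = ∑ e : E(G), if p e then 1 else 0 := by
  rw [← card_filter, ← Set.ncard_coe_finset,
    ← Set.ncard_image_of_injective _ (Subtype.val_injective (p := (· ∈ E(G))))]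
  congr 1
  ext e
  simp only [Set.mem_ofPred_eq, coe_filter, mem_univ, true_and, Set.mem_image, Subtype.exists,
    exists_and_right, exists_eq_right, exists_prop]
  exact ⟨fun h => ⟨hp e h, h⟩, fun h => h.2⟩

theorem degree_eq_sum [Fintype E(G)] (v : α) : G.degree v = ∑ e : E(G), G.incMult v e := by
  unfold degree incMult
  rw [sum_add_distrib]
  congr 1
  · exact ncard_eq_sum_edges _ fun e he => he.edge_mem
  · exact ncard_eq_sum_edges _ fun e he => he.edge_mem

open Classical in
theorem edgesAt_iff {v : α} {a b c : E(G)} : G.EdgesAt v a b c ↔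
    ∀ e : E(G), (if e = a then 1 else 0) + (if e = b then 1 else 0) +
      (if e = c then 1 else 0) = G.incMult v e := Iff.rfl

/-- The edges at `v`, counted with their ends, form a multiset of three elements. -/
theorem exists_edgesAt [Fintype E(G)] {v : α} (hv : G.degree v = 3) :
    ∃ a b c, G.EdgesAt v a b c := by
  classical
  let s : Multiset E(G) := ∑ e : E(G), Multiset.replicate (G.incMult v e) e
  have hcard : s.card = 3 := by
    simp only [s, Multiset.card_sum, Multiset.card_replicate]
    rw [← degree_eq_sum, hv]
  have hcount : ∀ e, s.count e = G.incMult v e := by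
    intro e
    simp only [s, Multiset.count_sum', Multiset.count_replicate]
    simp
  obtain ⟨a, b, c, hs⟩ := Multiset.card_eq_three.1 hcard
  refine ⟨a, b, c, edgesAt_iff.2 fun e => ?_⟩
  rw [← hcount, hs]
  simp only [Multiset.insert_eq_cons, Multiset.count_cons, Multiset.count_singleton]
  ring

theorem edge_eq_of_degree_eq_one [Fintype E(G)] {v : α} (hv : G.degree v = 1) {e f : β}
    (he : G.Inc e v) (hf : G.Inc f v) : e = f := by
  classical
  by_contra hne
  have h := degree_eq_sum (G := G) v
  have hle : ∀ g : β, G.Inc g v → 1 ≤ G.incMult v g := fun g hg => by simp [incMult, hg]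
  have hsub : ∑ g ∈ ({⟨e, he.edge_mem⟩, ⟨f, hf.edge_mem⟩} : Finset E(G)), G.incMult v g ≤
      ∑ g : E(G), G.incMult v g := sum_le_sum_of_subset (subset_univ _)
  rw [sum_pair (by simpa using hne)] at hsub
  have h1 := hle e he
  have h2 := hle f hf
  simp only at hsub
  omega

theorem not_isLoopAt_of_degree_eq_one [Fintype E(G)] {v : α} (hv : G.degree v = 1) (e : β) :
    ¬ G.IsLoopAt e v := by
  classical
  intro hl
  have h := degree_eq_sum (G := G) v
  have h1 : G.incMult v e = 2 := by simp [incMult, hl, hl.inc]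
  have h2 := single_le_sum (f := fun g : E(G) => G.incMult v g) (fun _ _ => Nat.zero_le _)
    (mem_univ ⟨e, hl.edge_mem⟩)
  simp only at h2
  omega

theorem exists_inc_of_degree_pos [Fintype E(G)] {v : α} (hv : 0 < G.degree v) :
    ∃ e, G.Inc e v := by
  classical
  by_contra! h
  have h0 : ∀ e, ¬ G.IsLoopAt e v := fun e hl => h e hl.inc
  rw [degree_eq_sum] at hv
  simp [incMult, h, h0] at hv

theorem IsOneThree.degree_eq_one (h13 : G.IsOneThree) {v : α} (hv : v ∈ V(G))
    (hvI : v ∉ G.internalNodes) : G.degree v = 1 :=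
  (h13 v hv).resolve_right fun h => hvI ⟨hv, h⟩

/-- An edge between two leaves is all of a connected graph. -/
theorem IsConnected.eq_or_eq_of_isLink_leaves [Fintype E(G)] (hconn : G.IsConnected)
    {e : β} {x y : α} (h : G.IsLink e x y) (hx : G.degree x = 1) (hy : G.degree y = 1)
    {v : α} (hv : v ∈ V(G)) : v = x ∨ v = y := by
  have := hconn.2 x h.left_mem v hv
  induction this with
  | refl => exact Or.inl rfl
  | tail hab hbc ih =>
    rename_i b c
    obtain ⟨f, hf⟩ := hbc
    have hfe : f = e := by
      rcases ih hf.left_mem with rfl | rfl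
      · exact edge_eq_of_degree_eq_one hx hf.inc_left h.inc_left
      · exact edge_eq_of_degree_eq_one hy hf.inc_left h.inc_right
    subst hfe
    exact hf.inc_right.eq_or_eq_of_isLink h

theorem exists_isLink_internal [Fintype E(G)] (h13 : G.IsOneThree) (hconn : G.IsConnected)
    (hI : G.internalNodes.Nonempty) (e : E(G)) :
    ∃ x y, G.IsLink e x y ∧ x ∈ G.internalNodes := by
  obtain ⟨x, y, h⟩ := G.exists_isLink_of_mem_edgeSet e.2
  by_cases hx : x ∈ G.internalNodes
  · exact ⟨x, y, h, hx⟩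
  by_cases hy : y ∈ G.internalNodes
  · exact ⟨y, x, h.symm, hy⟩
  exfalso
  obtain ⟨v, hv⟩ := hI
  rcases hconn.eq_or_eq_of_isLink_leaves h (h13.degree_eq_one h.left_mem hx)
    (h13.degree_eq_one h.right_mem hy) hv.1 with rfl | rfl
  exacts [hx hv, hy hv]

/-- The trivalent network of a connected graph with vertex degrees 1 and 3. -/
theorem exists_trivalentNet [Fintype E(G)] [Fintype G.internalNodes] (hV : V(G).Finite)
    (h13 : G.IsOneThree) (hconn : G.IsConnected) (hI : G.internalNodes.Nonempty) :
    ∃ N : TrivalentNet G.internalNodes E(G),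
      (∀ v e, N.mult v e = G.incMult v e) ∧ #N.internal ≤ Fintype.card E(G) ∧
      V(G).ncard = Fintype.card G.internalNodes + (Fintype.card E(G) - #N.internal) := by
  classical
  choose x y hlink hx using exists_isLink_internal h13 hconn hI
  have hprod : ∀ (e : E(G)) (f : G.internalNodes → ℝ), ∏ v, f v ^ G.incMult v e =
      f ⟨x e, hx e⟩ * if h : y e ∈ G.internalNodes then f ⟨y e, h⟩ else 1 := by
    intro e f
    have h1 : ∀ v : G.internalNodes, f v ^ G.incMult v e =
        (if v = ⟨x e, hx e⟩ then f v else 1) * (if (v : α) = y e then f v else 1) := by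
      intro v
      rw [(hlink e).incMult_eq, pow_add]
      congr 1
      · simp only [Subtype.ext_iff]
        split_ifs <;> simp
      · split_ifs <;> simp
    rw [prod_congr rfl (fun v _ => h1 v), prod_mul_distrib, prod_ite_eq']
    congr 1
    · simp
    · split_ifs with h
      · have : ∀ v : G.internalNodes, ((v : α) = y e) ↔ v = ⟨y e, h⟩ := fun v => by
          rw [Subtype.ext_iff]
        simp only [this, prod_ite_eq', mem_univ, if_true]
      · refine prod_eq_one fun v _ => if_neg ?_
        intro hv
        exact h (hv ▸ v.2)
  let int : Finset E(G) := univ.filter fun e => y e ∈ G.internalNodes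
  have hmem : ∀ e, e ∈ int ↔ y e ∈ G.internalNodes := fun e => by simp [int]
  refine ⟨{ mult := fun v e => G.incMult v e
            internal := int
            src := fun e => ⟨x e, hx e⟩
            -- For a leaf edge the value is never used and defaults to the source.
            tgt := fun e => if h : y e ∈ G.internalNodes then ⟨y e, h⟩ else ⟨x e, hx e⟩
            prod_internal := ?_
            prod_leaf := ?_
            exists_triple := fun v => by
              obtain ⟨a, b, c, h⟩ := exists_edgesAt v.2.2
              exact ⟨a, b, c, fun e => by convert edgesAt_iff.1 h e⟩
            connected := ?_ }, fun _ _ => rfl, card_le_univ _, ?_⟩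
  · intro e he f
    rw [hprod, dif_pos ((hmem e).1 he), dif_pos ((hmem e).1 he)]
  · intro e he f
    rw [hprod, dif_neg (fun h => he ((hmem e).2 h)), mul_one]
  · intro P hP u v hu
    have hP' : ∀ (e : β) (a b : α) (ha : a ∈ G.internalNodes) (hb : b ∈ G.internalNodes),
        G.IsLink e a b → P ⟨a, ha⟩ → P ⟨b, hb⟩ := by
      intro e a b ha hb hab hPa
      have h := hlink ⟨e, hab.edge_mem⟩
      have hPe := hP ⟨e, hab.edge_mem⟩
      rcases h.eq_and_eq_or_eq_and_eq hab with ⟨h1, h2⟩ | ⟨h1, h2⟩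
      · have hye : y ⟨e, hab.edge_mem⟩ ∈ G.internalNodes := by rw [h2]; exact hb
        rw [hmem, dif_pos hye] at hPe
        simp only [h1, h2] at hPe
        exact (hPe hb).1 hPa
      · have hye : y ⟨e, hab.edge_mem⟩ ∈ G.internalNodes := by rw [h2]; exact ha
        rw [hmem, dif_pos hye] at hPe
        simp only [h1, h2] at hPe
        exact (hPe ha).2 hPa
    -- A walk may run into a leaf, from which it can only return along the same edge; the second
    -- clause keeps the property of the neighbour for that moment.
    have key : ∀ w, Relation.ReflTransGen G.Adj u w →
        (∀ h : w ∈ G.internalNodes, P ⟨w, h⟩) ∧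
        (w ∉ G.internalNodes → ∀ (e : β) (b : α) (hb : b ∈ G.internalNodes),
          G.IsLink e w b → P ⟨b, hb⟩) := by
      intro w hw
      induction hw with
      | refl => exact ⟨fun _ => hu, fun h => absurd u.2 h⟩
      | tail hab hbc ih =>
        rename_i b c
        obtain ⟨e, he⟩ := hbc
        constructor
        · intro hc
          by_cases hb : b ∈ G.internalNodes
          · exact hP' e b c hb hc he (ih.1 hb)
          · exact ih.2 hb e c hc he
        · intro hc f d hd hf
          have hfe : f = e := edge_eq_of_degree_eq_one
            (h13.degree_eq_one he.right_mem hc) hf.inc_left he.inc_right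
          subst hfe
          have hdb : d = b := hf.right_unique he.symm
          subst hdb
          exact ih.1 hd
    exact (key v (hconn.2 u u.2.1 v v.2.1)).1 v.2
  · have hsub : G.internalNodes ⊆ V(G) := fun v hv => hv.1
    -- Each leaf is the far end of its only edge, so leaves and edges outside `int` are equally
    -- many.
    have hleaf : V(G) \ G.internalNodes = y '' ((intᶜ : Finset E(G)) : Set E(G)) := by
      ext v
      simp only [Set.mem_sdiff, Set.mem_image, coe_compl, Set.mem_compl_iff, mem_coe, hmem]
      constructor
      · rintro ⟨hv, hvI⟩
        have hd := h13.degree_eq_one hv hvI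
        obtain ⟨e, he⟩ := exists_inc_of_degree_pos (G := G) (v := v) (by omega)
        have hve : v = y ⟨e, he.edge_mem⟩ := by
          rcases he.eq_or_eq_of_isLink (hlink ⟨e, he.edge_mem⟩) with h | h
          · exact absurd (h ▸ hx _) hvI
          · exact h
        exact ⟨⟨e, he.edge_mem⟩, hve ▸ hvI, hve.symm⟩
      · rintro ⟨e, he, rfl⟩
        exact ⟨(hlink e).right_mem, he⟩
    have hinj : Set.InjOn y ((intᶜ : Finset E(G)) : Set E(G)) := by
      intro e he f hf hef
      simp only [coe_compl, Set.mem_compl_iff, mem_coe, hmem] at he hf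
      apply Subtype.ext
      refine edge_eq_of_degree_eq_one (h13.degree_eq_one (hlink e).right_mem he)
        (hlink e).inc_right ?_
      rw [hef]
      exact (hlink f).inc_right
    have h1 := Set.ncard_sdiff_add_ncard_of_subset hsub hV
    rw [hleaf, Set.InjOn.ncard_image hinj, Set.ncard_coe_finset, card_compl] at h1
    rw [← h1, ← Nat.card_coe_set_eq G.internalNodes, Nat.card_eq_fintype_card, add_comm]

end Graph

/-! ### Numbers of vertices and edges of trees and of connected graphs with a cycle -/

namespace Graph

variable {α β : Type*} {G : Graph α β}

/-- The simple graph on the vertices of `G` whose edges come from the edges in `F`. -/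
def simpleOn (G : Graph α β) (F : Set β) : SimpleGraph V(G) where
  Adj x y := x ≠ y ∧ ∃ e ∈ F, G.IsLink e x y
  symm := ⟨fun _ _ ⟨hne, e, he, h⟩ => ⟨hne.symm, e, he, h.symm⟩⟩
  loopless := ⟨fun _ h => h.1 rfl⟩

/-- A connected simple graph satisfies this bound, and its edges inject into `F` because an edge of
`G` determines its pair of ends. -/
theorem ncard_vertexSet_le_of_connected {F : Set β} (hF : F.Finite)
    (h : (G.simpleOn F).Connected) : V(G).ncard ≤ F.ncard + 1 := by
  have h1 := h.card_vert_le_card_edgeSet_add_one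
  rw [Nat.card_coe_set_eq] at h1
  refine h1.trans (Nat.add_le_add_right ?_ 1)
  have hex : ∀ s : (G.simpleOn F).edgeSet, ∃ e : F, ∃ x y : V(G),
      (s : Sym2 V(G)) = s(x, y) ∧ G.IsLink e x y := by
    rintro ⟨s, hs⟩
    induction s using Sym2.ind with
    | _ x y =>
      obtain ⟨-, e, he, hl⟩ := hs
      exact ⟨⟨e, he⟩, x, y, rfl, hl⟩
  choose f x y hs hl using hex
  have hf : Function.Injective f := by
    intro s t hst
    apply Subtype.ext
    rw [hs, hs]
    have h2 := hl s
    rw [hst] at h2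
    rcases h2.eq_and_eq_or_eq_and_eq (hl t) with ⟨h3, h4⟩ | ⟨h3, h4⟩
    · rw [Subtype.ext h3, Subtype.ext h4]
    · rw [Subtype.ext h3, Subtype.ext h4, Sym2.eq_swap]
  have := hF.to_subtype
  exact Nat.card_le_card_of_injective f hf

theorem IsConnected.simpleOn_connected (hconn : G.IsConnected) {F : Set β}
    (h : ∀ e (x y : V(G)), G.IsLink e x y → (G.simpleOn F).Reachable x y) :
    (G.simpleOn F).Connected := by
  have : Nonempty V(G) := hconn.1.to_subtype
  refine ⟨fun u v => ?_⟩
  have key : ∀ w, Relation.ReflTransGen G.Adj u w → ∀ hw : w ∈ V(G),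
      (G.simpleOn F).Reachable u ⟨w, hw⟩ := by
    intro w hw
    induction hw with
    | refl => exact fun _ => SimpleGraph.Reachable.refl _
    | tail hab hbc ih =>
      intro hc
      obtain ⟨e, he⟩ := hbc
      exact (ih he.left_mem).trans (h e ⟨_, he.left_mem⟩ ⟨_, hc⟩ he)
  exact key v (hconn.2 u u.2 v v.2) v.2

theorem simpleOn_reachable_of_isLink {F : Set β} {e : β} (he : e ∈ F) {x y : V(G)}
    (h : G.IsLink e x y) : (G.simpleOn F).Reachable x y := by
  by_cases hxy : x = y
  · rw [hxy]
  · exact SimpleGraph.Adj.reachable ⟨hxy, e, he, h⟩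

/-- A connected graph with a cycle has at least as many edges as vertices. -/
theorem IsConnected.ncard_vertexSet_le_of_not_isAcyclic (hE : E(G).Finite)
    (hconn : G.IsConnected) (hcyc : ¬ G.IsAcyclic) : V(G).ncard ≤ E(G).ncard := by
  unfold IsAcyclic at hcyc
  push Not at hcyc
  obtain ⟨n, x, e, -, he, hl⟩ := hcyc
  have hmem : ∀ i, x i ∈ V(G) := fun i => (hl i).left_mem
  -- Deleting an edge of a cycle keeps the graph connected, since the rest of the cycle joins `x 1`
  -- to `x 0`.
  set F := E(G) \ {e 0}
  have hpath : ∀ k : ℕ, k ≤ n → (G.simpleOn F).Reachable ⟨x 1, hmem 1⟩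
      ⟨x (Fin.ofNat (n + 1) (k + 1)), hmem _⟩ := by
    intro k
    induction k with
    | zero =>
      intro _
      rw [show Fin.ofNat (n + 1) (0 + 1) = 1 from rfl]
    | succ k ih =>
      intro hk
      refine (ih (by omega)).trans ?_
      have hli := hl (Fin.ofNat (n + 1) (k + 1))
      rw [show Fin.ofNat (n + 1) (k + 1) + 1 = Fin.ofNat (n + 1) (k + 1 + 1) from
        Fin.ext (by simp [Fin.val_add])] at hli
      refine simpleOn_reachable_of_isLink (e := e (Fin.ofNat (n + 1) (k + 1))) ?_ hli
      refine ⟨hli.edge_mem, fun h => ?_⟩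
      have h0 := congrArg Fin.val (he h)
      rw [Fin.val_ofNat, Nat.mod_eq_of_lt (by omega)] at h0
      simp at h0
  have h10 := hpath n le_rfl
  rw [show Fin.ofNat (n + 1) (n + 1) = 0 from Fin.ext (by simp)] at h10
  have hconn' : (G.simpleOn F).Connected := by
    refine hconn.simpleOn_connected fun f u v hf => ?_
    by_cases hfe : f = e 0
    · subst hfe
      have hl0 := hl 0
      rw [zero_add] at hl0
      rcases hf.eq_and_eq_or_eq_and_eq hl0 with ⟨h1, h2⟩ | ⟨h1, h2⟩
      · rw [show u = ⟨x 0, hmem 0⟩ from Subtype.ext h1, show v = ⟨x 1, hmem 1⟩ from Subtype.ext h2]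
        exact h10.symm
      · rw [show u = ⟨x 1, hmem 1⟩ from Subtype.ext h1, show v = ⟨x 0, hmem 0⟩ from Subtype.ext h2]
        exact h10
    · exact simpleOn_reachable_of_isLink (show f ∈ F from ⟨hf.edge_mem, hfe⟩) hf
  have h := ncard_vertexSet_le_of_connected (hE.subset Set.sdiff_subset) hconn'
  rwa [Set.ncard_sdiff_singleton_add_one (hl 0).edge_mem hE] at h

/-- A cycle of the simple graph has length at least 3, so the edges of `G` chosen for its steps are
distinct and form a cycle of `G`. -/
theorem IsAcyclic.simpleOn_isAcyclic (hac : G.IsAcyclic) (F : Set β) :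
    (G.simpleOn F).IsAcyclic := by
  intro v c hc
  have h3 := hc.three_le_length
  obtain ⟨n, hn⟩ : ∃ n, c.length = n + 1 := ⟨c.length - 1, by omega⟩
  have hadj : ∀ i : Fin (n + 1), (G.simpleOn F).Adj (c.getVert i) (c.getVert (i + 1 : Fin (n + 1))) := by
    intro i
    have h := c.adj_getVert_succ (i := i) (by omega)
    by_cases hi : i = Fin.last n
    · subst hi
      rw [Fin.last_add_one]
      simp only [Fin.val_last, Fin.val_zero, SimpleGraph.Walk.getVert_zero] at h ⊢
      rw [← hn, SimpleGraph.Walk.getVert_length] at h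
      exact h
    · rwa [Fin.val_add_one_of_lt (Fin.lt_last_iff_ne_last.2 hi)]
  choose hne e he hl using hadj
  have hinj : Function.Injective fun i : Fin (n + 1) => (c.getVert i : α) := by
    intro i j hij
    apply Fin.ext
    exact hc.getVert_injOn' (by simp only [Set.mem_ofPred_eq]; omega)
      (by simp only [Set.mem_ofPred_eq]; omega) (Subtype.ext hij)
  refine hac n (fun i => c.getVert i) e hinj ?_ hl
  intro i j hij
  have h := hl i
  rw [hij] at h
  rcases h.eq_and_eq_or_eq_and_eq (hl j) with ⟨h1, -⟩ | ⟨h1, h2⟩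
  · exact hinj h1
  -- An edge used in both directions would give i = j + 1 and j = i + 1, hence 2 = 0 modulo a length
  -- of at least 3.
  · exfalso
    have h4 : i = j + 1 := hinj h1
    have h5 : i + 1 = j := hinj h2
    rw [← h5, add_assoc, left_eq_add] at h4
    have h6 := congrArg Fin.val h4
    rw [Fin.val_add, Fin.val_one', Nat.mod_eq_of_lt (a := 1) (by omega),
      Nat.mod_eq_of_lt (by omega)] at h6
    simp at h6

/-- A tree has one vertex more than edges. -/
theorem IsTree.ncard_edgeSet_add_one (hV : V(G).Finite) (hE : E(G).Finite) (h : G.IsTree) :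
    E(G).ncard + 1 = V(G).ncard := by
  obtain ⟨hconn, hac⟩ := h
  have hH : (G.simpleOn E(G)).Connected :=
    hconn.simpleOn_connected fun e x y h => simpleOn_reachable_of_isLink h.edge_mem h
  refine le_antisymm ?_ (ncard_vertexSet_le_of_connected hE hH)
  have := hV.to_subtype
  have hT := (SimpleGraph.isTree_iff_connected_and_card.1 ⟨hH, hac.simpleOn_isAcyclic _⟩).2
  rw [Nat.card_coe_set_eq V(G)] at hT
  rw [← hT, ← Nat.card_coe_set_eq E(G)]
  refine Nat.add_le_add_right ?_ 1
  have hex : ∀ e : E(G), ∃ x y : V(G), G.IsLink e x y := fun e => by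
    obtain ⟨x, y, h⟩ := G.exists_isLink_of_mem_edgeSet e.2
    exact ⟨⟨x, h.left_mem⟩, ⟨y, h.right_mem⟩, h⟩
  choose x y hl using hex
  -- Loops and parallel pairs are cycles of length 1 and 2. Without them the edges inject into the
  -- edges of the simple graph, which is a tree.
  have hne : ∀ e, x e ≠ y e := by
    intro e hxy
    have : Subsingleton (Fin (0 + 1)) := inferInstanceAs (Subsingleton (Fin 1))
    refine hac 0 (fun _ => x e) (fun _ => e) (Function.injective_of_subsingleton _)
      (Function.injective_of_subsingleton _) fun _ => ?_
    have := hl e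
    rwa [← hxy] at this
  have hpar : ∀ e f : E(G), G.IsLink f (x e) (y e) → e = f := by
    intro e f hf
    by_contra hef
    refine hac 1 ![(x e : α), y e] ![(e : β), f] ?_ ?_ ?_
    · intro i j hij
      fin_cases i <;> fin_cases j <;> simp at hij ⊢
      · exact hne e (Subtype.ext hij)
      · exact hne e (Subtype.ext hij.symm)
    · intro i j hij
      fin_cases i <;> fin_cases j <;> simp at hij ⊢
      · exact hef (Subtype.ext hij)
      · exact hef (Subtype.ext hij.symm)
    · intro i
      fin_cases i
      · exact hl e
      · exact hf.symm
  have hfin : Finite (G.simpleOn E(G)).edgeSet := inferInstance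
  refine Nat.card_le_card_of_injective
    (fun e => (⟨s(x e, y e), hne e, e, e.2, hl e⟩ : (G.simpleOn E(G)).edgeSet)) ?_
  intro e f hef
  have h1 : s(x e, y e) = s(x f, y f) := congrArg Subtype.val hef
  apply hpar
  rcases Sym2.eq_iff.1 h1 with ⟨h2, h3⟩ | ⟨h2, h3⟩
  · rw [h2, h3]; exact hl f
  · rw [h2, h3]; exact (hl f).symm

end Graph

/-! ### Characters of the fusion rules -/

theorem sum_range_parity (F : ℕ → ℝ) (m : ℕ) :
    ∑ k ∈ range m, (1 + (-1) ^ k) * F k = 2 * ∑ a ∈ range ((m + 1) / 2), F (2 * a) := by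
  induction m with
  | zero => simp
  | succ m ih =>
    rw [sum_range_succ, ih]
    rcases Nat.even_or_odd m with h | h
    · obtain ⟨r, rfl⟩ := h
      rw [show (r + r + 1 + 1) / 2 = r + 1 by omega, show (r + r + 1) / 2 = r by omega,
        sum_range_succ, ← two_mul, pow_mul]
      norm_num
      ring
    · rw [h.neg_one_pow]
      obtain ⟨r, rfl⟩ := h
      rw [show (2 * r + 1 + 1 + 1) / 2 = r + 1 by omega, show (2 * r + 1 + 1) / 2 = r + 1 by omega]
      ring

/-- Discrete orthogonality of sines over odd multiples. -/
theorem sum_sin_odd_mul_sin_odd {n i j : ℕ} (hi : 0 < i) (hin : i < n) (hj : 0 < j)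
    (hjn : j < n) :
    ∑ a ∈ range (n / 2), Real.sin ((2 * a + 1 : ℕ) * (i * Real.pi / n)) *
      Real.sin ((2 * a + 1 : ℕ) * (j * Real.pi / n)) =
      (n / 4 : ℝ) * ((if i = j then 1 else 0) + (if i + j = n then 1 else 0)) := by
  have hn : (n : ℝ) ≠ 0 := Nat.cast_ne_zero.2 (by omega)
  have h1 := sum_sin_mul_sin (n := n) (r := i) (s := j) hi (by omega) hj hjn
  -- Replacing i by n - i multiplies the term with index k by (-1)^k. Adding the two relations keeps
  -- only even k, that is, odd multiples.
  have h2 := sum_sin_mul_sin (n := n) (r := n - i) (s := j) (by omega) (by omega) hj hjn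
  have h3 := sum_range_parity (fun k => Real.sin ((k + 1 : ℕ) * (i * Real.pi / n)) *
      Real.sin ((k + 1 : ℕ) * (j * Real.pi / n))) (n - 1)
  have h4 : ∑ k ∈ range (n - 1), (1 + (-1) ^ k) *
      (Real.sin ((k + 1 : ℕ) * (i * Real.pi / n)) * Real.sin ((k + 1 : ℕ) * (j * Real.pi / n))) =
      ∑ k ∈ range (n - 1),
      Real.sin (i * ((k + 1 : ℕ) * Real.pi / n)) * Real.sin (j * ((k + 1 : ℕ) * Real.pi / n)) +
      ∑ k ∈ range (n - 1), Real.sin ((n - i : ℕ) * ((k + 1 : ℕ) * Real.pi / n)) *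
        Real.sin (j * ((k + 1 : ℕ) * Real.pi / n)) := by
    rw [← sum_add_distrib]
    refine sum_congr rfl fun k _ => ?_
    have e1 : ((k + 1 : ℕ) * (i * Real.pi / n) : ℝ) = i * ((k + 1 : ℕ) * Real.pi / n) := by ring
    have e2 : ((k + 1 : ℕ) * (j * Real.pi / n) : ℝ) = j * ((k + 1 : ℕ) * Real.pi / n) := by ring
    have e3 : ((n - i : ℕ) * ((k + 1 : ℕ) * Real.pi / n) : ℝ) =
        (k + 1 : ℕ) * Real.pi - i * ((k + 1 : ℕ) * Real.pi / n) := by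
      rw [Nat.cast_sub hin.le]
      field_simp
    rw [e1, e2, e3, Real.sin_nat_mul_pi_sub, pow_succ]
    ring
  rw [h4, h1, h2, show (n - 1 + 1) / 2 = n / 2 by congr 1; omega] at h3
  have e5 : (if n - i = j then (1 : ℝ) else 0) = if i + j = n then 1 else 0 := by
    congr 1; rw [eq_iff_iff]; omega
  rw [if_neg (show ¬ (i + j = 2 * n) by omega), if_neg (show ¬ (n - i + j = 2 * n) by omega),
    e5] at h3
  linarith

/-- The values of the characters: quotients of sines. -/
noncomputable def sinChar (p : ℕ) (x : ℝ) : ℝ := Real.sin (p * x) / Real.sin x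

/-- The product formula for equal factors sin(Kx) · sin(Kx). These sums are the weights of the leaf
edges. -/
theorem sum_sinChar_odd (K : ℕ) {x : ℝ} (hx : Real.sin x ≠ 0) :
    ∑ a ∈ range K, sinChar (2 * a + 1) x = Real.sin (K * x) ^ 2 / Real.sin x ^ 2 := by
  have h := sin_mul_sin_eq_sum K K x
  have h1 : ∀ a : ℕ, Real.sin (((K : ℝ) - K + 1 + 2 * a) * x) =
      Real.sin ((2 * a + 1 : ℕ) * x) := by
    intro a
    congr 1
    push_cast
    ring
  simp only [h1] at h
  simp only [sinChar]
  rw [← sum_div, sq (Real.sin (K * x)), h, div_eq_div_iff hx (pow_ne_zero 2 hx)]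
  ring

/-- The sine formula in the shape that `TrivalentNet.ncard_labelings` expects: characters weighted
by reciprocal square norms. -/
theorem sinChar_fusion {n p q s : ℕ} (hp : 0 < p) (hpn : p < n) (hq : 0 < q)
    (hqn : q < n) (hs : 0 < s) (hsn : s < n) :
    (if p < q + s ∧ q < p + s ∧ s < p + q ∧ (p + q + s) % 2 = 1 ∧ p + q + s < 2 * n
        then (1 : ℝ) else 0) = ∑ j ∈ range (n - 1),
      (n / (2 * Real.sin ((j + 1 : ℕ) * Real.pi / n) ^ 2))⁻¹ *
      (sinChar p ((j + 1 : ℕ) * Real.pi / n) * sinChar q ((j + 1 : ℕ) * Real.pi / n) *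
        sinChar s ((j + 1 : ℕ) * Real.pi / n)) := by
  rw [← sum_sin_mul_sin_mul_sin_div hp hpn hq hqn hs hsn, mul_sum]
  refine sum_congr rfl fun j hj => ?_
  have hj' := mem_range.1 hj
  have := (sin_nat_mul_pi_div_pos (n := n) (j := j + 1) (by omega) (by omega)).ne'
  have hn : (n : ℝ) ≠ 0 := Nat.cast_ne_zero.2 (by omega)
  simp only [sinChar]
  field_simp

/-- This symmetry identifies the indices j and n - j on odd dimensions, and is the reason for
folding. -/
theorem sinChar_odd_pi_sub (a : ℕ) (x : ℝ) :
    sinChar (2 * a + 1) (Real.pi - x) = sinChar (2 * a + 1) x := by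
  have h : ((2 * a + 1 : ℕ) : ℝ) * (Real.pi - x) =
      (2 * a + 1 : ℕ) * Real.pi - (2 * a + 1 : ℕ) * x := by ring
  rw [sinChar, sinChar, h, Real.sin_nat_mul_pi_sub, Real.sin_pi_sub, pow_succ, pow_mul]
  norm_num

/-- The summand of the fusion rules for odd frequencies is symmetric. -/
theorem fusion_summand_symm {n : ℕ} {i j : ℕ} (hij : i + j + 2 = n) (a b c : ℕ) :
    ((n : ℝ) / (2 * Real.sin ((i + 1 : ℕ) * Real.pi / n) ^ 2))⁻¹ *
      (sinChar (2 * a + 1) ((i + 1 : ℕ) * Real.pi / n) *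
        sinChar (2 * b + 1) ((i + 1 : ℕ) * Real.pi / n) *
        sinChar (2 * c + 1) ((i + 1 : ℕ) * Real.pi / n)) =
    ((n : ℝ) / (2 * Real.sin ((j + 1 : ℕ) * Real.pi / n) ^ 2))⁻¹ *
      (sinChar (2 * a + 1) ((j + 1 : ℕ) * Real.pi / n) *
        sinChar (2 * b + 1) ((j + 1 : ℕ) * Real.pi / n) *
        sinChar (2 * c + 1) ((j + 1 : ℕ) * Real.pi / n)) := by
  have hn : (n : ℝ) ≠ 0 := Nat.cast_ne_zero.2 (by omega)
  have h : ((i + 1 : ℕ) * Real.pi / n : ℝ) = Real.pi - (j + 1 : ℕ) * Real.pi / n := by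
    rw [eq_sub_iff_add_eq, ← add_div, ← add_mul, ← Nat.cast_add,
      show i + 1 + (j + 1) = n by omega]
    field_simp
  rw [h, sinChar_odd_pi_sub, sinChar_odd_pi_sub, sinChar_odd_pi_sub, Real.sin_pi_sub]

/-- Triangle inequalities and the bound on the perimeter. -/
def TriangleLe (t a b c : ℤ) : Prop := a ≤ b + c ∧ b ≤ a + c ∧ c ≤ a + b ∧ a + b + c ≤ t

instance (t a b c : ℤ) : Decidable (TriangleLe t a b c) := by
  unfold TriangleLe; infer_instance

/-- Triangle inequalities, even perimeter, and the bound on the perimeter. -/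
def EvenTriangleLe (t a b c : ℤ) : Prop :=
  a ≤ b + c ∧ b ≤ a + c ∧ c ≤ a + b ∧ (a + b + c) % 2 = 0 ∧ a + b + c ≤ 2 * t

instance (t a b c : ℤ) : Decidable (EvenTriangleLe t a b c) := by
  unfold EvenTriangleLe; infer_instance

/-- For the dimensions 2a + 1, 2b + 1, 2c + 1 the sum is odd in any case, and the fusion bound 2(a +
b + c) + 3 < 2(t + 2) says a + b + c ≤ t. -/
theorem triangleLe_indicator {t a b c : ℕ} (ha : 2 * a ≤ t) (hb : 2 * b ≤ t) (hc : 2 * c ≤ t) :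
    (if TriangleLe t a b c then (1 : ℝ) else 0) = ∑ j ∈ range (t + 1),
      (((t + 2 : ℕ) : ℝ) / (2 * Real.sin ((j + 1 : ℕ) * Real.pi / (t + 2 : ℕ)) ^ 2))⁻¹ *
      (sinChar (2 * a + 1) ((j + 1 : ℕ) * Real.pi / (t + 2 : ℕ)) *
        sinChar (2 * b + 1) ((j + 1 : ℕ) * Real.pi / (t + 2 : ℕ)) *
        sinChar (2 * c + 1) ((j + 1 : ℕ) * Real.pi / (t + 2 : ℕ))) := by
  have h := sinChar_fusion (n := t + 2) (p := 2 * a + 1) (q := 2 * b + 1) (s := 2 * c + 1)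
    (by omega) (by omega) (by omega) (by omega) (by omega) (by omega)
  rw [show t + 2 - 1 = t + 1 by omega] at h
  rw [← h]
  congr 1
  rw [eq_iff_iff]
  unfold TriangleLe
  omega

/-! ### Labeling counts as sums over characters -/

namespace TrivalentNet

variable {I E : Type*} [Fintype I] [Fintype E] [Nonempty I] (N : TrivalentNet I E)

/-- The square norms of the characters for an even bound `2 s`. -/
noncomputable def normEven (s j : ℕ) : ℝ :=
  if j = s then s + 1 else (s + 1) / (2 * Real.sin ((j + 1 : ℕ) * Real.pi / (2 * s + 2 : ℕ)) ^ 2)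

/-- The sums of the characters for an even bound `2 s`. -/
noncomputable def leafEven (s j : ℕ) : ℝ :=
  if Even j then (Real.sin ((j + 1 : ℕ) * Real.pi / (2 * s + 2 : ℕ)) ^ 2)⁻¹ else 0

/-- The square norms of the characters for an odd bound `2 s + 1`. -/
noncomputable def normOdd (s k : ℕ) : ℝ :=
  (2 * s + 3) / (4 * Real.sin (2 * ((k + 1 : ℕ) * Real.pi / (2 * s + 3 : ℕ))) ^ 2)

/-- The sums of the characters for an odd bound `2 s + 1`. -/
noncomputable def leafOdd (s k : ℕ) : ℝ :=
  (4 * Real.cos ((k + 1 : ℕ) * Real.pi / (2 * s + 3 : ℕ)) ^ 2)⁻¹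

theorem triangleLe_bound {t a b c : ℤ} {M : ℕ} (hM : t < 2 * M) (h : TriangleLe t a b c) :
    (0 ≤ a ∧ a < M) ∧ (0 ≤ b ∧ b < M) ∧ (0 ≤ c ∧ c < M) := by
  unfold TriangleLe at h
  omega

/-- With n = 2s + 2, the indices 1, ..., s + 1 represent the classes of j ↦ n - j. The middle class
s + 1 is a fixed point: it occurs once instead of twice in the folded fusion rule, and its square
norm s + 1 is twice the generic expression. -/
theorem ncard_triangle_even (s : ℕ) :
    ({z : E → ℤ | ∀ v a b c, N.IsTriple v a b c →
      TriangleLe (2 * s : ℕ) (z a) (z b) (z c)}.ncard : ℝ) =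
      ∑ j ∈ range (s + 1), normEven s j ^ #N.internal *
        leafEven s j ^ (Fintype.card E - #N.internal) * ((normEven s j)⁻¹) ^ Fintype.card I := by
  let x : ℕ → ℝ := fun j => (j + 1 : ℕ) * Real.pi / (2 * s + 2 : ℕ)
  have hsin : ∀ j < s + 1, Real.sin (x j) ≠ 0 := fun j hj =>
    (sin_nat_mul_pi_div_pos (n := 2 * s + 2) (j := j + 1) (by omega) (by omega)).ne'
  have hxs : x s = Real.pi / 2 := by
    have : ((s : ℝ) + 1) ≠ 0 := by positivity
    simp only [x]
    push_cast
    field_simp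
  rw [N.ncard_labelings (J := Fin (s + 1)) (M := s + 1) (TriangleLe (2 * s : ℕ))
    (fun j a => sinChar (2 * a + 1) (x j)) (fun j => normEven s j)]
  · rw [Fin.sum_univ_eq_sum_range (fun j => normEven s j ^ #N.internal *
        (∑ a : Fin (s + 1), sinChar (2 * a + 1) (x j)) ^ (Fintype.card E - #N.internal) *
          ((normEven s j)⁻¹) ^ Fintype.card I)]
    refine sum_congr rfl fun j hj => ?_
    congr 3
    have hj' := mem_range.1 hj
    rw [Fin.sum_univ_eq_sum_range (fun a => sinChar (2 * a + 1) (x j)),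
      sum_sinChar_odd _ (hsin j hj')]
    -- The numerator of the leaf weight is the squared sine of (j + 1)π/2, which is 1 or 0 according
    -- to the parity of j.
    have hx : ((s + 1 : ℕ) : ℝ) * x j = (j + 1 : ℕ) * (Real.pi / 2) := by
      have : ((s : ℝ) + 1) ≠ 0 := by positivity
      simp only [x]
      push_cast
      field_simp
    rw [hx, leafEven]
    split_ifs with he
    · obtain ⟨r, rfl⟩ := he
      have : ((r + r + 1 : ℕ) : ℝ) * (Real.pi / 2) = r * Real.pi + Real.pi / 2 := by
        push_cast; ring
      rw [this, Real.sin_add_pi_div_two, Real.cos_nat_mul_pi, ← pow_mul, mul_comm r 2, pow_mul]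
      simp [x]
    · obtain ⟨r, rfl⟩ := Nat.not_even_iff_odd.1 he
      have : ((2 * r + 1 + 1 : ℕ) : ℝ) * (Real.pi / 2) = (r + 1 : ℕ) * Real.pi := by
        push_cast; ring
      rw [this, Real.sin_nat_mul_pi]
      simp
  · intro i j
    rw [Fin.sum_univ_eq_sum_range (fun a => sinChar (2 * a + 1) (x i) * sinChar (2 * a + 1) (x j))]
    have h := sum_sin_odd_mul_sin_odd (n := 2 * s + 2) (i := i + 1) (j := j + 1) (by omega)
      (by omega) (by omega) (by omega)
    rw [show (2 * s + 2) / 2 = s + 1 by omega] at h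
    have h1 : ∑ a ∈ range (s + 1), sinChar (2 * a + 1) (x i) * sinChar (2 * a + 1) (x j) =
        (∑ a ∈ range (s + 1), Real.sin ((2 * a + 1 : ℕ) * x i) *
          Real.sin ((2 * a + 1 : ℕ) * x j)) / (Real.sin (x i) * Real.sin (x j)) := by
      rw [sum_div]
      refine sum_congr rfl fun a _ => ?_
      simp only [sinChar]
      rw [div_mul_div_comm]
    rw [h1, h]
    have hi := hsin i i.2
    have hj := hsin j j.2
    by_cases hij : i = j
    · subst hij
      by_cases his : (i : ℕ) = s
      · rw [normEven, if_pos his, if_pos rfl, if_pos rfl, if_pos (by omega), his, hxs]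
        push_cast
        rw [Real.sin_pi_div_two]
        ring
      · rw [normEven, if_neg his, if_pos rfl, if_pos rfl, if_neg (by omega)]
        change _ = ((s : ℝ) + 1) / (2 * Real.sin (x i) ^ 2)
        push_cast
        field_simp
        ring
    · rw [if_neg hij, if_neg (fun h => hij (Fin.ext (by omega))), if_neg (fun h => hij (Fin.ext (by omega)))]
      simp
  · intro a b c
    rw [triangleLe_indicator (by omega) (by omega) (by omega),
      sum_range_fold_even (fun j hj => fusion_summand_symm (by omega) _ _ _),
      Fin.sum_univ_eq_sum_range (fun j => (normEven s j)⁻¹ * (sinChar (2 * a + 1) (x j) *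
        sinChar (2 * b + 1) (x j) * sinChar (2 * c + 1) (x j))), sum_range_succ, mul_sum]
    congr 1
    · refine sum_congr rfl fun j hj => ?_
      have hj' := mem_range.1 hj
      rw [normEven, if_neg hj'.ne, ← mul_assoc]
      congr 1
      have := hsin j (by omega)
      simp only [x] at this
      have hs : ((s : ℝ) + 1) ≠ 0 := by positivity
      push_cast at this ⊢
      field_simp
    · rw [normEven, if_pos rfl]
      congr 1
      change (((2 * s + 2 : ℕ) : ℝ) / (2 * Real.sin (x s) ^ 2))⁻¹ = _
      rw [hxs, Real.sin_pi_div_two]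
      push_cast
      congr 1
      ring
  · exact fun a b c h => triangleLe_bound (by push_cast; omega) h

/-- As n = 2s + 3 is odd, folding has no fixed point, and the even indices 2k + 2 represent the
classes. With y = (k + 1)π/n the angle is 2y, and the leaf weight sin²y / sin²2y becomes 1 / (4
cos²y). -/
theorem ncard_triangle_odd (s : ℕ) :
    ({z : E → ℤ | ∀ v a b c, N.IsTriple v a b c →
      TriangleLe (2 * s + 1 : ℕ) (z a) (z b) (z c)}.ncard : ℝ) =
      ∑ k ∈ range (s + 1), normOdd s k ^ #N.internal *
        leafOdd s k ^ (Fintype.card E - #N.internal) * ((normOdd s k)⁻¹) ^ Fintype.card I := by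
  have hs3 : (2 * (s : ℝ) + 3) ≠ 0 := by positivity
  let x : ℕ → ℝ := fun k => (2 * k + 1 + 1 : ℕ) * Real.pi / (2 * s + 3 : ℕ)
  have hsin : ∀ k < s + 1, Real.sin (x k) ≠ 0 := fun k hk =>
    (sin_nat_mul_pi_div_pos (n := 2 * s + 3) (j := 2 * k + 1 + 1) (by omega) (by omega)).ne'
  have hx2 : ∀ k, x k = 2 * ((k + 1 : ℕ) * Real.pi / (2 * s + 3 : ℕ)) := by
    intro k
    simp only [x]
    push_cast
    ring
  rw [N.ncard_labelings (J := Fin (s + 1)) (M := s + 1) (TriangleLe (2 * s + 1 : ℕ))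
    (fun j a => sinChar (2 * a + 1) (x j)) (fun j => normOdd s j)]
  · rw [Fin.sum_univ_eq_sum_range (fun j => normOdd s j ^ #N.internal *
        (∑ a : Fin (s + 1), sinChar (2 * a + 1) (x j)) ^ (Fintype.card E - #N.internal) *
          ((normOdd s j)⁻¹) ^ Fintype.card I)]
    refine sum_congr rfl fun k hk => ?_
    congr 3
    have hk' := mem_range.1 hk
    rw [Fin.sum_univ_eq_sum_range (fun a => sinChar (2 * a + 1) (x k)),
      sum_sinChar_odd _ (hsin k hk'), leafOdd]
    have h0 := hsin k hk'
    obtain ⟨y, hy⟩ : ∃ y : ℝ, y = (k + 1 : ℕ) * Real.pi / (2 * s + 3 : ℕ) := ⟨_, rfl⟩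
    have hx : ((s + 1 : ℕ) : ℝ) * x k = (k + 1 : ℕ) * Real.pi - y := by
      rw [hx2, hy]
      push_cast
      field_simp
      ring
    rw [hx, Real.sin_nat_mul_pi_sub]
    rw [hx2, ← hy, Real.sin_two_mul] at h0
    rw [hx2, ← hy, Real.sin_two_mul]
    have h1 : Real.sin y ≠ 0 := fun h => h0 (by rw [h]; ring)
    have h2 : Real.cos y ≠ 0 := fun h => h0 (by rw [h]; ring)
    rw [neg_sq, mul_pow, ← pow_mul, mul_comm (k + 1) 2, pow_mul]
    norm_num
    field_simp
    norm_num
  · intro i j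
    rw [Fin.sum_univ_eq_sum_range (fun a => sinChar (2 * a + 1) (x i) * sinChar (2 * a + 1) (x j))]
    have h := sum_sin_odd_mul_sin_odd (n := 2 * s + 3) (i := 2 * i + 1 + 1) (j := 2 * j + 1 + 1)
      (by omega) (by omega) (by omega) (by omega)
    rw [show (2 * s + 3) / 2 = s + 1 by omega] at h
    have h1 : ∑ a ∈ range (s + 1), sinChar (2 * a + 1) (x i) * sinChar (2 * a + 1) (x j) =
        (∑ a ∈ range (s + 1), Real.sin ((2 * a + 1 : ℕ) * x i) *
          Real.sin ((2 * a + 1 : ℕ) * x j)) / (Real.sin (x i) * Real.sin (x j)) := by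
      rw [sum_div]
      refine sum_congr rfl fun a _ => ?_
      simp only [sinChar]
      rw [div_mul_div_comm]
    rw [h1, h, if_neg (show ¬ (2 * (i : ℕ) + 1 + 1 + (2 * j + 1 + 1) = 2 * s + 3) by omega)]
    have hi := hsin i i.2
    by_cases hij : i = j
    · subst hij
      rw [if_pos rfl, if_pos rfl, normOdd, ← hx2]
      push_cast
      field_simp
      ring
    · rw [if_neg hij, if_neg (fun h => hij (Fin.ext (by omega)))]
      simp
  · intro a b c
    rw [triangleLe_indicator (by omega) (by omega) (by omega),
      show 2 * s + 1 + 1 = 2 * (s + 1) by ring,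
      sum_range_fold_odd (fun j hj => fusion_summand_symm (by omega) _ _ _),
      Fin.sum_univ_eq_sum_range (fun j => (normOdd s j)⁻¹ * (sinChar (2 * a + 1) (x j) *
        sinChar (2 * b + 1) (x j) * sinChar (2 * c + 1) (x j))), mul_sum]
    refine sum_congr rfl fun k hk => ?_
    have hk' := mem_range.1 hk
    rw [normOdd, ← mul_assoc, ← hx2]
    congr 1
    have h0 := hsin k (by omega)
    change 2 * (((2 * s + 3 : ℕ) : ℝ) / (2 * Real.sin (x k) ^ 2))⁻¹ = _
    push_cast
    field_simp
    norm_num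
  · exact fun a b c h => triangleLe_bound (by push_cast; omega) h

/-- All dimensions a + 1 with a ≤ t occur, so nothing is folded, and the parity condition of the
fusion rule is the evenness of the perimeter. -/
theorem ncard_evenTriangle (t : ℕ) :
    ({z : E → ℤ | ∀ v a b c, N.IsTriple v a b c →
      EvenTriangleLe t (z a) (z b) (z c)}.ncard : ℝ) =
      ∑ j ∈ range (t + 1),
        ((t + 2) / (2 * Real.sin ((j + 1 : ℕ) * Real.pi / (t + 2 : ℕ)) ^ 2)) ^ #N.internal *
        (∑ a ∈ range (t + 1), sinChar (a + 1) ((j + 1 : ℕ) * Real.pi / (t + 2 : ℕ))) ^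
          (Fintype.card E - #N.internal) *
        (((t + 2) / (2 * Real.sin ((j + 1 : ℕ) * Real.pi / (t + 2 : ℕ)) ^ 2))⁻¹) ^
          Fintype.card I := by
  let x : ℕ → ℝ := fun j => (j + 1 : ℕ) * Real.pi / (t + 2 : ℕ)
  have hsin : ∀ j < t + 1, Real.sin (x j) ≠ 0 := fun j hj =>
    (sin_nat_mul_pi_div_pos (n := t + 2) (j := j + 1) (by omega) (by omega)).ne'
  rw [N.ncard_labelings (J := Fin (t + 1)) (M := t + 1) (EvenTriangleLe t)
    (fun j a => sinChar (a + 1) (x j)) (fun j => (t + 2) / (2 * Real.sin (x j) ^ 2))]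
  · rw [Fin.sum_univ_eq_sum_range (fun j =>
        (((t : ℝ) + 2) / (2 * Real.sin (x j) ^ 2)) ^ #N.internal *
        (∑ a : Fin (t + 1), sinChar (a + 1) (x j)) ^ (Fintype.card E - #N.internal) *
          (((t + 2) / (2 * Real.sin (x j) ^ 2))⁻¹) ^ Fintype.card I)]
    refine sum_congr rfl fun j _ => ?_
    rw [Fin.sum_univ_eq_sum_range (fun a => sinChar (a + 1) (x j))]
  · intro i j
    rw [Fin.sum_univ_eq_sum_range (fun a => sinChar (a + 1) (x i) * sinChar (a + 1) (x j))]
    have h := sum_sin_mul_sin (n := t + 2) (r := i + 1) (s := j + 1) (by omega)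
      (by omega) (by omega) (by omega)
    rw [show t + 2 - 1 = t + 1 by omega,
      if_neg (show ¬ ((i : ℕ) + 1 + (j + 1) = 2 * (t + 2)) by omega), sub_zero] at h
    have h1 : ∑ a ∈ range (t + 1), sinChar (a + 1) (x i) * sinChar (a + 1) (x j) =
        (∑ a ∈ range (t + 1), Real.sin ((i + 1 : ℕ) * ((a + 1 : ℕ) * Real.pi / (t + 2 : ℕ))) *
          Real.sin ((j + 1 : ℕ) * ((a + 1 : ℕ) * Real.pi / (t + 2 : ℕ)))) /
            (Real.sin (x i) * Real.sin (x j)) := by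
      rw [sum_div]
      refine sum_congr rfl fun a _ => ?_
      simp only [sinChar]
      rw [div_mul_div_comm]
      congr 3 <;> · simp only [x]; ring
    rw [h1, h]
    have hi := hsin i i.2
    by_cases hij : i = j
    · subst hij
      rw [if_pos rfl, if_pos rfl]
      push_cast
      field_simp
    · rw [if_neg hij, if_neg (fun h => hij (Fin.ext (by omega)))]
      simp
  · intro a b c
    have h := sinChar_fusion (n := t + 2) (p := a + 1) (q := b + 1) (s := c + 1)
      (by omega) (by omega) (by omega) (by omega) (by omega) (by omega)
    rw [show t + 2 - 1 = t + 1 by omega] at h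
    rw [Fin.sum_univ_eq_sum_range (fun j => (((t : ℝ) + 2) / (2 * Real.sin (x j) ^ 2))⁻¹ *
      (sinChar (a + 1) (x j) * sinChar (b + 1) (x j) * sinChar (c + 1) (x j)))]
    rw [Nat.cast_add, Nat.cast_two] at h
    simp only [x, Nat.cast_add t 2, Nat.cast_two]
    rw [← h]
    congr 1
    rw [eq_iff_iff]
    unfold EvenTriangleLe
    omega
  · intro a b c h
    unfold EvenTriangleLe at h
    omega

/-- The number of even edge sets. -/
theorem ncard_even :
    ({z : E → ℤ | ∀ v a b c, N.IsTriple v a b c →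
      (0 ≤ z a ∧ z a < 2) ∧ (0 ≤ z b ∧ z b < 2) ∧ (0 ≤ z c ∧ z c < 2) ∧
        (z a + z b + z c) % 2 = 0}.ncard : ℝ) =
      2 ^ #N.internal * 2 ^ (Fintype.card E - #N.internal) * (2⁻¹) ^ Fintype.card I +
        2 ^ #N.internal * 0 ^ (Fintype.card E - #N.internal) * (2⁻¹) ^ Fintype.card I := by
  -- The characters of the group of order 2, both of square norm 2; the nontrivial one has leaf
  -- weight 0.
  rw [N.ncard_labelings (J := Fin 2) (M := 2)
    (fun a b c => (0 ≤ a ∧ a < 2) ∧ (0 ≤ b ∧ b < 2) ∧ (0 ≤ c ∧ c < 2) ∧ (a + b + c) % 2 = 0)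
    (fun j a => ((-1) ^ (j : ℕ)) ^ (a : ℕ)) (fun _ => 2)]
  · simp [Fin.sum_univ_two]
    norm_num
  · intro i j
    fin_cases i <;> fin_cases j <;> simp [Fin.sum_univ_two] ; norm_num
  · intro a b c
    fin_cases a <;> fin_cases b <;> fin_cases c <;> simp [Fin.sum_univ_two] <;> norm_num
  · intro a b c h
    push_cast
    tauto

end TrivalentNet

/-! ### Lattice points of dilates as labelings -/

namespace Graph

variable {α β : Type*} {G : Graph α β}

theorem isTriple_iff [Fintype E(G)] [Fintype G.internalNodes]
    {N : TrivalentNet G.internalNodes E(G)} (hN : ∀ v e, N.mult v e = G.incMult v e)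
    (v : G.internalNodes) (a b c : E(G)) : N.IsTriple v a b c ↔ G.EdgesAt v a b c := by
  rw [edgesAt_iff]
  unfold TrivalentNet.IsTriple
  refine forall_congr' fun e => ?_
  rw [hN]
  constructor <;> (intro h; convert h)

/-- An edge on its own supplies at most 2 to the degree of its internal end. -/
theorem not_isEdgeComponent [Fintype E(G)] (h13 : G.IsOneThree) (hconn : G.IsConnected)
    (hI : G.internalNodes.Nonempty) (e : E(G)) : ¬ G.IsEdgeComponent e := by
  classical
  intro h
  obtain ⟨x, y, hl, hx⟩ := exists_isLink_internal h13 hconn hI e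
  have h3 := hx.2
  rw [degree_eq_sum, sum_eq_single e] at h3
  · unfold incMult at h3
    split_ifs at h3 <;> omega
  · intro f _ hf
    have hinc : ¬ G.Inc f x := fun hfx => hf (Subtype.ext (h f x hl.inc_left hfx))
    have hloop : ¬ G.IsLoopAt f x := fun hfx => hinc hfx.inc
    simp [incMult, hinc, hloop]
  · simp

theorem intCast_mem_smul_iff {ι : Type*} {P : Set (ι → ℝ)} {t : ℕ} (ht : t ≠ 0) (z : ι → ℝ) :
    z ∈ (t : ℝ) • P ↔ (fun i => z i / t) ∈ P := by
  have ht' : (t : ℝ) ≠ 0 := Nat.cast_ne_zero.2 ht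
  rw [Set.mem_smul_set_iff_inv_smul_mem₀ ht']
  have : (t : ℝ)⁻¹ • z = fun i => z i / t := by
    funext i
    simp [div_eq_inv_mul]
  rw [this]

theorem triangle_div_iff {t : ℕ} (ht : t ≠ 0) (a b c : ℤ) :
    ((a : ℝ) / t ≤ b / t + c / t ∧ (b : ℝ) / t ≤ a / t + c / t ∧ (c : ℝ) / t ≤ a / t + b / t) ↔
      a ≤ b + c ∧ b ≤ a + c ∧ c ≤ a + b := by
  have ht' : (0 : ℝ) < t := by positivity
  simp only [← add_div, div_le_div_iff_of_pos_right ht']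
  norm_cast

/-- The dilate by t = 0 is the origin, and the triangle inequalities with perimeter at most 0 also
leave only the zero labeling; for t > 0 one clears denominators. -/
theorem ehrhart_polytopeP_eq [Fintype E(G)] [Fintype G.internalNodes] (h13 : G.IsOneThree)
    (hconn : G.IsConnected) (hI : G.internalNodes.Nonempty)
    {N : TrivalentNet G.internalNodes E(G)} (hN : ∀ v e, N.mult v e = G.incMult v e) (t : ℕ) :
    ehrhart G.polytopeP t = {z : E(G) → ℤ | ∀ v a b c, N.IsTriple v a b c →
      TriangleLe t (z a) (z b) (z c)}.ncard := by
  unfold ehrhart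
  congr 1
  ext z
  simp only [Set.mem_ofPred_eq]
  rcases eq_or_ne t 0 with rfl | ht
  · have hne : G.polytopeP.Nonempty := ⟨0, by simp [polytopeP]⟩
    rw [Nat.cast_zero, Set.zero_smul_set hne, Set.mem_zero]
    constructor
    · intro hz v a b c _
      have hz' : ∀ e, z e = 0 := fun e => Int.cast_eq_zero.1 (congrFun hz e)
      simp [TriangleLe, hz']
    · intro hz
      funext e
      obtain ⟨v, a, b, c, h, he⟩ := N.exists_isTriple_mem e
      have := hz v a b c h
      unfold TriangleLe at this
      have h0 : z e = 0 := by rcases he with rfl | rfl | rfl <;> omega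
      simp [h0]
  · rw [intCast_mem_smul_iff ht]
    have ht' : (0 : ℝ) < t := by positivity
    simp only [polytopeP, Set.mem_ofPred_eq, not_isEdgeComponent h13 hconn hI, false_imp_iff,
      implies_true, and_true, isTriple_iff hN, TriangleLe]
    rw [Subtype.forall]
    refine forall₂_congr fun v _ => forall₃_congr fun a b c => imp_congr_right fun _ => ?_
    have h1 := triangle_div_iff ht (z a) (z b) (z c)
    have h2 : (z a : ℝ) / t + z b / t + z c / t ≤ 1 ↔ z a + z b + z c ≤ t := by
      rw [← add_div, ← add_div, div_le_one ht']
      norm_cast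
    rw [h2]
    tauto

/-- Forgetting the node coordinates is injective, since they are half the perimeters; their
integrality becomes the evenness of the perimeters. -/
theorem ehrhart_polytopeQ_eq [Fintype E(G)] [Fintype G.internalNodes] (h13 : G.IsOneThree)
    (hconn : G.IsConnected) (hI : G.internalNodes.Nonempty)
    {N : TrivalentNet G.internalNodes E(G)} (hN : ∀ v e, N.mult v e = G.incMult v e) (t : ℕ) :
    ehrhart G.polytopeQ t = {z : E(G) → ℤ | ∀ v a b c, N.IsTriple v a b c →
      EvenTriangleLe t (z a) (z b) (z c)}.ncard := by
  have hmem : ∀ y : E(G) ⊕ G.internalNodes → ℤ,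
      (fun i => (y i : ℝ)) ∈ (t : ℝ) • G.polytopeQ ↔ ∀ v a b c, N.IsTriple v a b c →
        y (.inl a) ≤ y (.inl b) + y (.inl c) ∧ y (.inl b) ≤ y (.inl a) + y (.inl c) ∧
        y (.inl c) ≤ y (.inl a) + y (.inl b) ∧
        y (.inl a) + y (.inl b) + y (.inl c) = 2 * y (.inr v) ∧ y (.inr v) ≤ t := by
    intro y
    rcases eq_or_ne t 0 with rfl | ht
    · have hne : G.polytopeQ.Nonempty := ⟨0, by simp [polytopeQ]⟩
      rw [Nat.cast_zero, Set.zero_smul_set hne, Set.mem_zero]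
      constructor
      · intro hz v a b c _
        have hz' : ∀ e, y e = 0 := fun e => Int.cast_eq_zero.1 (congrFun hz e)
        simp [hz']
      · intro hz
        funext i
        rcases i with e | v
        · obtain ⟨v, a, b, c, h, he⟩ := N.exists_isTriple_mem e
          have := hz v a b c h
          have h0 : y (.inl e) = 0 := by rcases he with rfl | rfl | rfl <;> omega
          simp [h0]
        · obtain ⟨a, b, c, h⟩ := N.exists_triple v
          have := hz v a b c h
          have h0 : y (.inr v) = 0 := by omega
          simp [h0]
    · rw [intCast_mem_smul_iff ht]
      have ht' : (0 : ℝ) < t := by positivity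
      simp only [polytopeQ, Set.mem_ofPred_eq, not_isEdgeComponent h13 hconn hI, false_imp_iff,
        implies_true, and_true, isTriple_iff hN]
      refine forall_congr' fun v => forall₃_congr fun a b c => imp_congr_right fun _ => ?_
      have h1 := triangle_div_iff ht (y (.inl a)) (y (.inl b)) (y (.inl c))
      have h2 : (y (.inl a) : ℝ) / t + y (.inl b) / t + y (.inl c) / t = 2 * (y (.inr v) / t) ↔
          y (.inl a) + y (.inl b) + y (.inl c) = 2 * y (.inr v) := by
        rw [← add_div, ← add_div, ← mul_div_assoc, div_left_inj' ht'.ne']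
        norm_cast
      have h3 : (y (.inr v) : ℝ) / t ≤ 1 ↔ y (.inr v) ≤ t := by
        rw [div_le_one ht']
        norm_cast
      rw [h2, h3]
      tauto
  unfold ehrhart
  simp only [hmem]
  have himg : {z : E(G) → ℤ | ∀ v a b c, N.IsTriple v a b c →
      EvenTriangleLe t (z a) (z b) (z c)} = (fun y : E(G) ⊕ G.internalNodes → ℤ =>
        fun e => y (.inl e)) '' {y | ∀ v a b c, N.IsTriple v a b c →
        y (.inl a) ≤ y (.inl b) + y (.inl c) ∧ y (.inl b) ≤ y (.inl a) + y (.inl c) ∧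
        y (.inl c) ≤ y (.inl a) + y (.inl b) ∧
        y (.inl a) + y (.inl b) + y (.inl c) = 2 * y (.inr v) ∧ y (.inr v) ≤ t} := by
    ext z
    simp only [Set.mem_ofPred_eq, Set.mem_image, EvenTriangleLe]
    constructor
    · intro hz
      choose a b c habc using N.exists_triple
      refine ⟨Sum.elim z fun v => (z (a v) + z (b v) + z (c v)) / 2, ?_, rfl⟩
      intro v a' b' c' h
      have h1 := hz v a' b' c' h
      -- The perimeter does not depend on the order in which the three edges are listed.
      have hsum : z a' + z b' + z c' = z (a v) + z (b v) + z (c v) := by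
        classical
        have key : ∀ p q r, N.IsTriple v p q r →
            z p + z q + z r = ∑ e, (N.mult v e : ℤ) * z e := by
          intro p q r hpqr
          simp only [← hpqr _, Nat.cast_add, Nat.cast_ite, Nat.cast_one, Nat.cast_zero, add_mul,
            sum_add_distrib, ite_mul, one_mul, zero_mul, sum_ite_eq', mem_univ, if_true]
        rw [key _ _ _ h, key _ _ _ (habc v)]
      simp only [Sum.elim_inl, Sum.elim_inr]
      omega
    · rintro ⟨y, hy, rfl⟩ v a b c h
      have := hy v a b c h
      simp only
      omega
  rw [himg, Set.InjOn.ncard_image]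
  intro y hy y' hy' hyy
  funext i
  rcases i with e | v
  · exact congrFun hyy e
  · obtain ⟨a, b, c, h⟩ := N.exists_triple v
    have h1 := hy v a b c h
    have h2 := hy' v a b c h
    have ha : y (.inl a) = y' (.inl a) := congrFun hyy a
    have hb : y (.inl b) = y' (.inl b) := congrFun hyy b
    have hc : y (.inl c) = y' (.inl c) := congrFun hyy c
    omega

/-- Edge sets are encoded by 0-1 labelings. The three labels at a node add up to its degree in the
subgraph, which is at most 3, so degree 0 or 2 means an even sum. -/
theorem numInternallyEulerian_eq [Fintype E(G)] [Fintype G.internalNodes]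
    {N : TrivalentNet G.internalNodes E(G)} (hN : ∀ v e, N.mult v e = G.incMult v e) :
    G.numInternallyEulerian = {z : E(G) → ℤ | ∀ v a b c, N.IsTriple v a b c →
      (0 ≤ z a ∧ z a < 2) ∧ (0 ≤ z b ∧ z b < 2) ∧ (0 ≤ z c ∧ z c < 2) ∧
        (z a + z b + z c) % 2 = 0}.ncard := by
  classical
  unfold numInternallyEulerian
  let φ : Set β → E(G) → ℤ := fun S e => if (e : β) ∈ S then 1 else 0
  have hdeg : ∀ S : Set β, ∀ v a b c, N.IsTriple v a b c →
      ((G.restrict S).degree v : ℤ) = φ S a + φ S b + φ S c := by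
    intro S v a b c h
    have h1 : ((G.restrict S).degree v : ℤ) = ∑ e : E(G), (N.mult v e : ℤ) * φ S e := by
      unfold degree incidenceSet loopSet
      simp only [restrict_inc, restrict_isLoopAt]
      rw [ncard_eq_sum_edges _ fun e he => he.1.edge_mem,
        ncard_eq_sum_edges _ fun e he => he.1.edge_mem, ← sum_add_distrib, Nat.cast_sum]
      refine sum_congr rfl fun e _ => ?_
      rw [hN]
      simp only [incMult, φ]
      by_cases hS : (e : β) ∈ S <;> simp [hS]
    rw [h1]
    simp only [← h _, Nat.cast_add, Nat.cast_ite, Nat.cast_one, Nat.cast_zero, add_mul,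
      sum_add_distrib, ite_mul, one_mul, zero_mul, sum_ite_eq', mem_univ, if_true]
  have h01 : ∀ S e, φ S e = 0 ∨ φ S e = 1 := by
    intro S e
    simp only [φ]
    split_ifs <;> simp
  have himg : {z : E(G) → ℤ | ∀ v a b c, N.IsTriple v a b c →
      (0 ≤ z a ∧ z a < 2) ∧ (0 ≤ z b ∧ z b < 2) ∧ (0 ≤ z c ∧ z c < 2) ∧
        (z a + z b + z c) % 2 = 0} = φ '' {S : Set β | S ⊆ E(G) ∧
    ∀ v ∈ G.internalNodes, (G.restrict S).degree v = 0 ∨ (G.restrict S).degree v = 2} := by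
    ext z
    simp only [Set.mem_ofPred_eq, Set.mem_image]
    constructor
    · intro hz
      have hz' : ∀ e, z e = 0 ∨ z e = 1 := by
        intro e
        obtain ⟨v, a, b, c, h, he⟩ := N.exists_isTriple_mem e
        have := hz v a b c h
        rcases he with rfl | rfl | rfl <;> omega
      have hφ : φ (Subtype.val '' {e | z e = 1}) = z := by
        funext e
        have : ((e : β) ∈ (Subtype.val '' {e | z e = 1} : Set β)) ↔ z e = 1 := by simp
        simp only [φ, this]
        rcases hz' e with h | h <;> simp [h]
      refine ⟨Subtype.val '' {e | z e = 1}, ⟨by simp, fun v hv => ?_⟩, hφ⟩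
      obtain ⟨a, b, c, h⟩ := N.exists_triple ⟨v, hv⟩
      have h1 := hdeg (Subtype.val '' {e | z e = 1}) ⟨v, hv⟩ a b c h
      rw [hφ] at h1
      have h2 := hz _ a b c h
      simp only at h1
      omega
    · rintro ⟨S, ⟨-, hS⟩, rfl⟩ v a b c h
      have h1 := hdeg S v a b c h
      have h2 := hS v v.2
      have ha := h01 S a
      have hb := h01 S b
      have hc := h01 S c
      omega
  rw [himg, Set.InjOn.ncard_image]
  intro S hS T hT hST
  ext e
  by_cases he : e ∈ E(G)
  · have h := congrFun hST ⟨e, he⟩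
    simp only [φ] at h
    by_cases h1 : e ∈ S <;> by_cases h2 : e ∈ T <;> simp_all
  · exact ⟨fun h => absurd (hS.1 h) he, fun h => absurd (hT.1 h) he⟩

end Graph

open TrivalentNet

/-! ### Evaluation of the character sums -/

theorem sin_succ_mul_pi_div_symm {n i j : ℕ} (hij : i + j + 2 = n) :
    Real.sin ((i + 1 : ℕ) * Real.pi / n) = Real.sin ((j + 1 : ℕ) * Real.pi / n) := by
  have hn : (n : ℝ) ≠ 0 := Nat.cast_ne_zero.2 (by omega)
  have h : ((i + 1 : ℕ) * Real.pi / n : ℝ) = Real.pi - (j + 1 : ℕ) * Real.pi / n := by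
    rw [eq_sub_iff_add_eq, ← add_div, ← add_mul, ← Nat.cast_add,
      show i + 1 + (j + 1) = n by omega]
    field_simp
  rw [h, Real.sin_pi_sub]

theorem sin_succ_mul_pi_div_middle (s : ℕ) :
    Real.sin ((s + 1 : ℕ) * Real.pi / (2 * s + 2 : ℕ)) = 1 := by
  have : ((s : ℝ) + 1) ≠ 0 := by positivity
  rw [← Real.sin_pi_div_two]
  congr 1
  push_cast
  field_simp

theorem cscSum_even (m s : ℕ) : cscSum m (2 * s + 2) =
    2 * ∑ j ∈ range s, ((Real.sin ((j + 1 : ℕ) * Real.pi / (2 * s + 2 : ℕ)) ^ 2)⁻¹) ^ m + 1 := by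
  rw [cscSum, show 2 * s + 2 - 1 = 2 * s + 1 by omega, sum_range_fold_even]
  · rw [sin_succ_mul_pi_div_middle]
    simp
  · intro j hj
    rw [sin_succ_mul_pi_div_symm (i := 2 * s - j) (j := j) (by omega)]

theorem sum_range_even_add_odd (F : ℕ → ℝ) (s : ℕ) : ∑ k ∈ range (2 * s + 1), F k =
    ∑ k ∈ range (2 * s + 1), (if Even k then F k else 0) + ∑ k ∈ range s, F (2 * k + 1) := by
  induction s with
  | zero => simp
  | succ s ih =>
    rw [show 2 * (s + 1) + 1 = 2 * s + 1 + 1 + 1 by ring, sum_range_succ, sum_range_succ, ih,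
      sum_range_succ _ (2 * s + 1 + 1), sum_range_succ _ (2 * s + 1), sum_range_succ _ s,
      if_neg (show ¬ Even (2 * s + 1) by simp), if_pos (show Even (2 * s + 1 + 1) from ⟨s + 1, by ring⟩)]
    ring

/-- The sum over odd multiples of `π / (2 s + 2)` below `π / 2`. -/
theorem two_mul_sum_csc_odd (m s : ℕ) :
    2 * ∑ j ∈ range s, (if Even j then
      ((Real.sin ((j + 1 : ℕ) * Real.pi / (2 * s + 2 : ℕ)) ^ 2)⁻¹) ^ m else 0) +
      (if Even s then 1 else 0) = cscSum m (2 * s + 2) - cscSum m (s + 1) := by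
  have h1 := sum_range_even_add_odd
    (fun j => ((Real.sin ((j + 1 : ℕ) * Real.pi / (2 * s + 2 : ℕ)) ^ 2)⁻¹) ^ m) s
  have h2 : ∑ k ∈ range s,
      ((Real.sin ((2 * k + 1 + 1 : ℕ) * Real.pi / (2 * s + 2 : ℕ)) ^ 2)⁻¹) ^ m =
      cscSum m (s + 1) := by
    rw [cscSum, show s + 1 - 1 = s by omega]
    refine sum_congr rfl fun k _ => ?_
    have : ((2 * k + 1 + 1 : ℕ) * Real.pi / (2 * s + 2 : ℕ) : ℝ) =
        (k + 1 : ℕ) * Real.pi / (s + 1 : ℕ) := by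
      have : ((s : ℝ) + 1) ≠ 0 := by positivity
      push_cast
      field_simp
      ring
    rw [this]
  rw [h2] at h1
  have h3 : cscSum m (2 * s + 2) = ∑ j ∈ range (2 * s + 1),
      ((Real.sin ((j + 1 : ℕ) * Real.pi / (2 * s + 2 : ℕ)) ^ 2)⁻¹) ^ m := rfl
  rw [h3, h1, sum_range_fold_even, sin_succ_mul_pi_div_middle]
  · simp
  · intro j hj
    rw [sin_succ_mul_pi_div_symm (i := 2 * s - j) (j := j) (by omega)]
    congr 1
    rw [eq_iff_iff, Nat.even_sub (by omega)]
    simp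

theorem sum_csc_half (m s : ℕ) :
    ∑ k ∈ range (s + 1), ((Real.sin ((k + 1 : ℕ) * Real.pi / (2 * s + 3 : ℕ)) ^ 2)⁻¹) ^ m =
      cscSum m (2 * s + 3) / 2 := by
  have h : cscSum m (2 * s + 3) = ∑ k ∈ range (s + 1),
        ((Real.sin ((k + 1 : ℕ) * Real.pi / (2 * s + 3 : ℕ)) ^ 2)⁻¹) ^ m +
      ∑ k ∈ range (s + 1),
        ((Real.sin ((s + 1 + k + 1 : ℕ) * Real.pi / (2 * s + 3 : ℕ)) ^ 2)⁻¹) ^ m := by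
    rw [cscSum, show 2 * s + 3 - 1 = (s + 1) + (s + 1) by omega, sum_range_add]
  rw [h, ← sum_range_reflect (fun k =>
    ((Real.sin ((s + 1 + k + 1 : ℕ) * Real.pi / (2 * s + 3 : ℕ)) ^ 2)⁻¹) ^ m)]
  have h2 : ∀ k ∈ range (s + 1),
      ((Real.sin ((s + 1 + (s + 1 - 1 - k) + 1 : ℕ) * Real.pi / (2 * s + 3 : ℕ)) ^ 2)⁻¹) ^ m =
      ((Real.sin ((k + 1 : ℕ) * Real.pi / (2 * s + 3 : ℕ)) ^ 2)⁻¹) ^ m := by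
    intro k hk
    have hk' := mem_range.1 hk
    rw [sin_succ_mul_pi_div_symm (i := s + 1 + (s + 1 - 1 - k)) (j := k) (by omega)]
  rw [sum_congr rfl h2]
  ring

/-- Passing to complementary angles gives sines at the odd multiples of π / (2(2s + 3)) below π/2;
the subtracted 1 is the term at π/2. -/
theorem sum_sec_half (m s : ℕ) :
    ∑ k ∈ range (s + 1), ((Real.cos ((k + 1 : ℕ) * Real.pi / (2 * s + 3 : ℕ)) ^ 2)⁻¹) ^ m =
      (cscSum m (2 * (2 * s + 3)) - cscSum m (2 * s + 3) - 1) / 2 := by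
  have h := two_mul_sum_csc_odd m (2 * (s + 1))
  rw [if_pos (even_two_mul _), show 2 * (2 * (s + 1)) + 2 = 2 * (2 * s + 3) by ring,
    show 2 * (s + 1) + 1 = 2 * s + 3 by ring] at h
  rw [← h]
  have h1 : ∀ (r : ℕ) (F : ℕ → ℝ), ∑ j ∈ range (2 * r), (if Even j then F j else 0) =
      ∑ j ∈ range r, F (2 * j) := by
    intro r F
    induction r with
    | zero => simp
    | succ r ih =>
      rw [show 2 * (r + 1) = 2 * r + 1 + 1 by ring, sum_range_succ, sum_range_succ, ih,
        if_pos (even_two_mul r), if_neg (show ¬ Even (2 * r + 1) by simp), sum_range_succ]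
      ring
  rw [h1, ← sum_range_reflect]
  have h2 : ∀ k ∈ range (s + 1),
      ((Real.cos ((s + 1 - 1 - k + 1 : ℕ) * Real.pi / (2 * s + 3 : ℕ)) ^ 2)⁻¹) ^ m =
      ((Real.sin ((2 * k + 1 : ℕ) * Real.pi / (2 * (2 * s + 3) : ℕ)) ^ 2)⁻¹) ^ m := by
    intro k hk
    have hk' := mem_range.1 hk
    have hs : (2 * (s : ℝ) + 3) ≠ 0 := by positivity
    have : ((s + 1 - 1 - k + 1 : ℕ) * Real.pi / (2 * s + 3 : ℕ) : ℝ) =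
        Real.pi / 2 - (2 * k + 1 : ℕ) * Real.pi / (2 * (2 * s + 3) : ℕ) := by
      rw [show s + 1 - 1 - k + 1 = s - k + 1 by omega]
      push_cast [Nat.cast_sub (show k ≤ s by omega)]
      field_simp
      ring
    rw [this, Real.cos_pi_div_two_sub]
  rw [sum_congr rfl h2]
  ring

theorem normEven_self (s : ℕ) : normEven s s = s + 1 := if_pos rfl

theorem normEven_of_lt {s j : ℕ} (h : j < s) : normEven s j =
    (s + 1) / 2 * (Real.sin ((j + 1 : ℕ) * Real.pi / (2 * s + 2 : ℕ)) ^ 2)⁻¹ := by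
  rw [normEven, if_neg h.ne]
  ring

theorem leafEven_self (s : ℕ) : leafEven s s = if Even s then 1 else 0 := by
  rw [leafEven, sin_succ_mul_pi_div_middle]
  simp

theorem sum_normEven_pow (h s : ℕ) : ∑ j ∈ range (s + 1), normEven s j ^ h =
    ((s + 1) / 2) ^ h * ((cscSum h (2 * s + 2) - 1) / 2) + (s + 1) ^ h := by
  rw [sum_range_succ, normEven_self, cscSum_even]
  congr 1
  rw [add_sub_cancel_right, mul_div_cancel_left₀ _ two_ne_zero, mul_sum]
  refine sum_congr rfl fun j hj => ?_
  rw [normEven_of_lt (mem_range.1 hj), mul_pow]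

theorem sum_normEven_pow_mul_leafEven_pow (h l s : ℕ) :
    ∑ j ∈ range (s + 1), normEven s j ^ h * leafEven s j ^ (l + 1) =
      ((s + 1) / 2) ^ h * ((cscSum (h + (l + 1)) (2 * s + 2) - cscSum (h + (l + 1)) (s + 1) -
        (if Even s then 1 else 0)) / 2) + (if Even s then 1 else 0) * (s + 1) ^ h := by
  rw [sum_range_succ, normEven_self, leafEven_self, ← two_mul_sum_csc_odd]
  congr 1
  · rw [add_sub_cancel_right, mul_div_cancel_left₀ _ two_ne_zero, mul_sum]
    refine sum_congr rfl fun j hj => ?_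
    rw [normEven_of_lt (mem_range.1 hj), mul_pow, leafEven]
    split_ifs
    · rw [pow_add]; ring
    · simp
  · split_ifs <;> simp

/-- The inverse norm of the middle class is half the generic expression, so the folded sum is
exactly the unfolded sum over odd multiples. Hence no dependence on the parity of s survives for
trees. -/
theorem sum_inv_normEven_mul_leafEven_pow (l s : ℕ) :
    ∑ j ∈ range (s + 1), (normEven s j)⁻¹ * leafEven s j ^ (l + 1) =
      (cscSum l (2 * s + 2) - cscSum l (s + 1)) / (s + 1) := by
  have hs : ((s : ℝ) + 1) ≠ 0 := by positivity
  rw [sum_range_succ, normEven_self, leafEven_self, ← two_mul_sum_csc_odd, add_div]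
  congr 1
  · rw [mul_div_right_comm, mul_sum]
    refine sum_congr rfl fun j hj => ?_
    have hj' := mem_range.1 hj
    have := (sin_nat_mul_pi_div_pos (n := 2 * s + 2) (j := j + 1) (by omega) (by omega)).ne'
    rw [normEven_of_lt hj', leafEven]
    split_ifs
    · have hY := inv_ne_zero (pow_ne_zero 2 this)
      generalize (Real.sin ((j + 1 : ℕ) * Real.pi / (2 * s + 2 : ℕ)) ^ 2)⁻¹ = Y at *
      field_simp
      ring
    · simp
  · split_ifs <;> simp

theorem sin_cos_ne_zero {s k : ℕ} (hk : k < s + 1) :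
    Real.sin ((k + 1 : ℕ) * Real.pi / (2 * s + 3 : ℕ)) ≠ 0 ∧
      Real.cos ((k + 1 : ℕ) * Real.pi / (2 * s + 3 : ℕ)) ≠ 0 := by
  have h := (sin_nat_mul_pi_div_pos (n := 2 * s + 3) (j := 2 * (k + 1)) (by omega) (by omega)).ne'
  have e : ((2 * (k + 1) : ℕ) * Real.pi / (2 * s + 3 : ℕ) : ℝ) =
      2 * ((k + 1 : ℕ) * Real.pi / (2 * s + 3 : ℕ)) := by push_cast; ring
  rw [e, Real.sin_two_mul] at h
  exact ⟨fun h0 => h (by rw [h0]; ring), fun h0 => h (by rw [h0]; ring)⟩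

theorem normOdd_eq (s k : ℕ) : normOdd s k = (2 * s + 3) / 16 *
    ((Real.sin ((k + 1 : ℕ) * Real.pi / (2 * s + 3 : ℕ)) ^ 2)⁻¹ *
      (Real.cos ((k + 1 : ℕ) * Real.pi / (2 * s + 3 : ℕ)) ^ 2)⁻¹) := by
  rw [normOdd, Real.sin_two_mul]
  generalize (Real.sin ((k + 1 : ℕ) * Real.pi / (2 * s + 3 : ℕ))) = y
  generalize (Real.cos ((k + 1 : ℕ) * Real.pi / (2 * s + 3 : ℕ))) = z
  rw [← mul_inv, ← div_eq_mul_inv, div_div]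
  congr 1
  ring

theorem sum_normOdd_pow_mul_leafOdd_pow (h l s : ℕ) :
    ∑ k ∈ range (s + 1), normOdd s k ^ h * leafOdd s k ^ l =
      ((2 * s + 3) / 16) ^ h * (1 / 4) ^ l * ∑ k ∈ range (s + 1),
        ((Real.sin ((k + 1 : ℕ) * Real.pi / (2 * s + 3 : ℕ)) ^ 2)⁻¹) ^ h *
        ((Real.cos ((k + 1 : ℕ) * Real.pi / (2 * s + 3 : ℕ)) ^ 2)⁻¹) ^ (h + l) := by
  rw [mul_sum]
  refine sum_congr rfl fun k _ => ?_
  rw [normOdd_eq, leafOdd, mul_inv, mul_pow, mul_pow, mul_pow, pow_add]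
  ring

/-- The inverse norm is a multiple of sin²y cos²y, and sin²y = 1 - cos²y splits each term into a
difference of two powers of the secant. -/
theorem sum_inv_normOdd_mul_leafOdd_pow (l s : ℕ) :
    ∑ k ∈ range (s + 1), (normOdd s k)⁻¹ * leafOdd s k ^ (l + 2) =
      16 * (1 / 4) ^ (l + 2) / (2 * s + 3) *
        ((cscSum (l + 1) (2 * (2 * s + 3)) - cscSum (l + 1) (2 * s + 3)) / 2 -
          (cscSum l (2 * (2 * s + 3)) - cscSum l (2 * s + 3)) / 2) := by
  have h1 : (cscSum (l + 1) (2 * (2 * s + 3)) - cscSum (l + 1) (2 * s + 3)) / 2 -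
      (cscSum l (2 * (2 * s + 3)) - cscSum l (2 * s + 3)) / 2 = ∑ k ∈ range (s + 1),
      (((Real.cos ((k + 1 : ℕ) * Real.pi / (2 * s + 3 : ℕ)) ^ 2)⁻¹) ^ (l + 1) -
      ((Real.cos ((k + 1 : ℕ) * Real.pi / (2 * s + 3 : ℕ)) ^ 2)⁻¹) ^ l) := by
    rw [sum_sub_distrib, sum_sec_half, sum_sec_half]
    ring
  rw [h1, mul_sum]
  refine sum_congr rfl fun k hk => ?_
  obtain ⟨hy, hz⟩ := sin_cos_ne_zero (mem_range.1 hk)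
  have hsq := Real.sin_sq_add_cos_sq ((k + 1 : ℕ) * Real.pi / (2 * s + 3 : ℕ))
  rw [normOdd_eq, leafOdd]
  generalize (Real.sin ((k + 1 : ℕ) * Real.pi / (2 * s + 3 : ℕ))) = y at *
  generalize (Real.cos ((k + 1 : ℕ) * Real.pi / (2 * s + 3 : ℕ))) = z at *
  have hs : (2 * (s : ℝ) + 3) ≠ 0 := by positivity
  have hY : z ^ 2 * (z ^ 2)⁻¹ = 1 := mul_inv_cancel₀ (pow_ne_zero 2 hz)
  rw [mul_inv, mul_inv, mul_inv, inv_inv, inv_inv, mul_pow, inv_div]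
  rw [show y ^ 2 = 1 - z ^ 2 by linarith, show (4 : ℝ)⁻¹ = 1 / 4 by norm_num]
  generalize (z ^ 2)⁻¹ = Y at *
  generalize z ^ 2 = u at *
  linear_combination (16 / (2 * (s : ℝ) + 3) * (1 / 4) ^ (l + 2) * Y ^ l * (Y * (1 - u) - 1)) * hY

/-! ### Polynomials -/

open Polynomial in
/-- Partial fractions in two variables with `x + y = x y`. -/
theorem exists_partial_fractions (p q : ℕ) :
    ∃ A B : ℝ[X], ∀ x y : ℝ, x + y = x * y → x ^ p * y ^ q = A.eval x + B.eval y := by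
  induction hn : p + q generalizing p q with
  | zero =>
    obtain ⟨rfl, rfl⟩ : p = 0 ∧ q = 0 := by omega
    exact ⟨1, 0, fun x y _ => by simp⟩
  | succ n ih =>
    match p, q with
    | 0, q => exact ⟨0, X ^ q, fun x y _ => by simp⟩
    | p + 1, 0 => exact ⟨X ^ (p + 1), 0, fun x y _ => by simp⟩
    | p + 1, q + 1 =>
      obtain ⟨A, B, h1⟩ := ih (p + 1) q (by omega)
      obtain ⟨A', B', h2⟩ := ih p (q + 1) (by omega)
      refine ⟨A + A', B + B', fun x y hxy => ?_⟩
      have h3 : x ^ (p + 1) * y ^ (q + 1) = x ^ (p + 1) * y ^ q + x ^ p * y ^ (q + 1) := by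
        linear_combination -(x ^ p * y ^ q) * hxy
      rw [h3, h1 x y hxy, h2 x y hxy, eval_add, eval_add]
      ring

open Polynomial in
/-- Sums of polynomial values are polynomial if the power sums are. -/
theorem exists_polynomial_sum_eval (r : ℕ → ℕ → ℝ) (ν : ℕ → ℝ)
    (h : ∀ m : ℕ, ∃ p : ℝ[X], ∀ s, ∑ k ∈ range (s + 1), r s k ^ m = p.eval (ν s)) (A : ℝ[X]) :
    ∃ p : ℝ[X], ∀ s, ∑ k ∈ range (s + 1), A.eval (r s k) = p.eval (ν s) := by
  choose p hp using h
  refine ⟨∑ i ∈ range (A.natDegree + 1), C (A.coeff i) * p i, fun s => ?_⟩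
  rw [eval_finsetSum, sum_congr rfl (fun k _ => eval_eq_sum_range (p := A) (r s k)), sum_comm]
  refine sum_congr rfl fun i _ => ?_
  rw [← mul_sum, hp i s, eval_mul, eval_C]

open Polynomial in
-- The numbers 1/sin²y and 1/cos²y have equal sum and product, so partial fractions reduce the mixed
-- sum to power sums of each.
theorem exists_polynomial_odd (h l : ℕ) : ∃ p : ℝ[X], ∀ s : ℕ,
    ∑ k ∈ range (s + 1), normOdd s k ^ h * leafOdd s k ^ l = p.eval ((2 * s + 1 : ℕ) : ℝ) := by
  obtain ⟨A, B, hAB⟩ := exists_partial_fractions h (h + l)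
  obtain ⟨a, ha⟩ := exists_polynomial_sum_eval
    (fun s k => (Real.sin ((k + 1 : ℕ) * Real.pi / (2 * s + 3 : ℕ)) ^ 2)⁻¹)
    (fun s => ((2 * s + 3 : ℕ) : ℝ)) (fun m => by
      obtain ⟨p, hp⟩ := exists_polynomial_cscSum m
      refine ⟨C (1 / 2) * p, fun s => ?_⟩
      rw [sum_csc_half, hp _ (by omega), eval_mul, eval_C]
      ring) A
  obtain ⟨b, hb⟩ := exists_polynomial_sum_eval
    (fun s k => (Real.cos ((k + 1 : ℕ) * Real.pi / (2 * s + 3 : ℕ)) ^ 2)⁻¹)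
    (fun s => ((2 * s + 3 : ℕ) : ℝ)) (fun m => by
      obtain ⟨p, hp⟩ := exists_polynomial_cscSum m
      refine ⟨C (1 / 2) * (p.comp (C 2 * X) - p - 1), fun s => ?_⟩
      rw [sum_sec_half, hp _ (by omega), hp _ (by omega)]
      simp only [eval_mul, eval_sub, eval_comp, eval_C, eval_X, eval_one]
      push_cast
      ring) B
  refine ⟨((C (1 / 16) * X) ^ h * C ((1 / 4) ^ l) * (a + b)).comp (X + C 2), fun s => ?_⟩
  rw [sum_normOdd_pow_mul_leafOdd_pow]
  have hsum : ∑ k ∈ range (s + 1),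
        ((Real.sin ((k + 1 : ℕ) * Real.pi / (2 * s + 3 : ℕ)) ^ 2)⁻¹) ^ h *
        ((Real.cos ((k + 1 : ℕ) * Real.pi / (2 * s + 3 : ℕ)) ^ 2)⁻¹) ^ (h + l) =
      (a + b).eval ((2 * s + 3 : ℕ) : ℝ) := by
    rw [eval_add, ← ha, ← hb, ← sum_add_distrib]
    refine sum_congr rfl fun k hk => hAB _ _ ?_
    obtain ⟨hy, hz⟩ := sin_cos_ne_zero (mem_range.1 hk)
    have hsq := Real.sin_sq_add_cos_sq ((k + 1 : ℕ) * Real.pi / (2 * s + 3 : ℕ))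
    generalize (Real.sin ((k + 1 : ℕ) * Real.pi / (2 * s + 3 : ℕ))) = y at *
    generalize (Real.cos ((k + 1 : ℕ) * Real.pi / (2 * s + 3 : ℕ))) = z at *
    field_simp
    linarith
  rw [hsum]
  simp only [eval_comp, eval_mul, eval_pow, eval_C, eval_X, eval_add]
  have : ((2 * s + 1 : ℕ) : ℝ) + 2 = (2 * s + 3 : ℕ) := by push_cast; ring
  rw [this]
  push_cast
  ring

open Polynomial in
theorem exists_eq_X_mul {p : ℝ[X]} (h : p.eval 0 = 0) : ∃ q : ℝ[X], p = X * q := by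
  have : X ∣ p := by rw [X_dvd_iff, coeff_zero_eq_eval_zero, h]
  exact this

open Polynomial in
-- The division by s + 1 is exact because p(2x) - p(x) has no constant term.
theorem exists_polynomial_even_tree (l : ℕ) : ∃ p : ℝ[X], ∀ s : ℕ,
    ∑ j ∈ range (s + 1), (normEven s j)⁻¹ * leafEven s j ^ (l + 1) =
      p.eval ((2 * s : ℕ) : ℝ) := by
  obtain ⟨p, hp⟩ := exists_polynomial_cscSum l
  obtain ⟨q, hq⟩ := exists_eq_X_mul (p := p.comp (C 2 * X) - p) (by simp [eval_comp])
  refine ⟨q.comp (C (1 / 2) * X + 1), fun s => ?_⟩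
  have hs : ((s : ℝ) + 1) ≠ 0 := by positivity
  rw [sum_inv_normEven_mul_leafEven_pow, hp _ (by omega), hp _ (by omega)]
  have h := congrArg (eval ((s : ℝ) + 1)) hq
  simp only [eval_sub, eval_comp, eval_mul, eval_C, eval_X] at h
  have e1 : ((2 * s + 2 : ℕ) : ℝ) = 2 * ((s : ℝ) + 1) := by push_cast; ring
  have e2 : (1 / 2 * ((2 * s : ℕ) : ℝ) + 1) = (s : ℝ) + 1 := by push_cast; ring
  rw [e1, show ((s + 1 : ℕ) : ℝ) = (s : ℝ) + 1 by push_cast; ring, h]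
  simp only [eval_comp, eval_mul, eval_C, eval_X, eval_add, eval_one]
  rw [e2]
  field_simp

open Polynomial in
theorem exists_polynomial_odd_tree (l : ℕ) : ∃ p : ℝ[X], ∀ s : ℕ,
    ∑ k ∈ range (s + 1), (normOdd s k)⁻¹ * leafOdd s k ^ (l + 2) =
      p.eval ((2 * s + 1 : ℕ) : ℝ) := by
  obtain ⟨p, hp⟩ := exists_polynomial_cscSum l
  obtain ⟨p', hp'⟩ := exists_polynomial_cscSum (l + 1)
  obtain ⟨q, hq⟩ := exists_eq_X_mul (p := p.comp (C 2 * X) - p) (by simp [eval_comp])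
  obtain ⟨q', hq'⟩ := exists_eq_X_mul (p := p'.comp (C 2 * X) - p') (by simp [eval_comp])
  refine ⟨(C (16 * (1 / 4) ^ (l + 2) / 2) * (q' - q)).comp (X + C 2), fun s => ?_⟩
  have hs : (2 * (s : ℝ) + 3) ≠ 0 := by positivity
  rw [sum_inv_normOdd_mul_leafOdd_pow, hp _ (by omega), hp _ (by omega), hp' _ (by omega),
    hp' _ (by omega)]
  have h := congrArg (eval (2 * (s : ℝ) + 3)) hq
  have h' := congrArg (eval (2 * (s : ℝ) + 3)) hq'
  simp only [eval_sub, eval_comp, eval_mul, eval_C, eval_X] at h h'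
  have e1 : ((2 * (2 * s + 3) : ℕ) : ℝ) = 2 * (2 * (s : ℝ) + 3) := by push_cast; ring
  have e3 : ((2 * s + 3 : ℕ) : ℝ) = 2 * (s : ℝ) + 3 := by push_cast; ring
  have e2 : ((2 * s + 1 : ℕ) : ℝ) + 2 = 2 * (s : ℝ) + 3 := by push_cast; ring
  rw [e1, e3, h, h']
  simp only [eval_comp, eval_mul, eval_C, eval_X, eval_add, eval_sub]
  rw [e2]
  field_simp

/-! ### Periods -/

theorem exists_hasPeriod_le_two {f : ℕ → ℕ} {p q : Polynomial ℝ}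
    (hp : ∀ s : ℕ, (f (2 * s) : ℝ) = p.eval ((2 * s : ℕ) : ℝ))
    (hq : ∀ s : ℕ, (f (2 * s + 1) : ℝ) = q.eval ((2 * s + 1 : ℕ) : ℝ)) :
    ∃ n ≤ 2, HasPeriod f n := by
  have h2 : 2 ∈ {m : ℕ | 0 < m ∧ ∃ p : Fin m → Polynomial ℝ, IsConstituents f p} := by
    refine ⟨by norm_num, ![p, q], fun t i hi => ?_⟩
    fin_cases i
    · obtain ⟨s, rfl⟩ : ∃ s, t = 2 * s := ⟨t / 2, by simp at hi; omega⟩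
      exact hp s
    · obtain ⟨s, rfl⟩ : ∃ s, t = 2 * s + 1 := ⟨t / 2, by simp at hi; omega⟩
      exact hq s
  exact ⟨_, Nat.sInf_le h2, Nat.sInf_mem ⟨2, h2⟩, fun m hm => Nat.sInf_le hm⟩

theorem eq_of_eval_arith_eq {p q : Polynomial ℝ} (a b : ℕ) (ha : 0 < a)
    (h : ∀ k : ℕ, p.eval ((a * k + b : ℕ) : ℝ) = q.eval ((a * k + b : ℕ) : ℝ)) : p = q := by
  apply Polynomial.eq_of_infinite_eval_eq
  refine (Set.infinite_range_of_injective (f := fun k : ℕ => ((a * k + b : ℕ) : ℝ)) ?_).mono ?_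
  · intro k l hkl
    have : a * k + b = a * l + b := Nat.cast_injective (R := ℝ) hkl
    exact Nat.eq_of_mul_eq_mul_left ha (by omega)
  · rintro _ ⟨k, rfl⟩
    exact h k

theorem hasPeriod_four {f : ℕ → ℕ} {p₀ p₂ q : Polynomial ℝ}
    (h0 : ∀ s : ℕ, (f (4 * s) : ℝ) = p₀.eval ((4 * s : ℕ) : ℝ))
    (h2 : ∀ s : ℕ, (f (4 * s + 2) : ℝ) = p₂.eval ((4 * s + 2 : ℕ) : ℝ))
    (hq : ∀ s : ℕ, (f (2 * s + 1) : ℝ) = q.eval ((2 * s + 1 : ℕ) : ℝ))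
    (hne : p₀ ≠ p₂) : HasPeriod f 4 := by
  refine ⟨⟨by norm_num, ![p₀, q, p₂, q], fun t i hi => ?_⟩, ?_⟩
  · fin_cases i
    · obtain ⟨s, rfl⟩ : ∃ s, t = 4 * s := ⟨t / 4, by simp at hi; omega⟩
      exact h0 s
    · obtain ⟨s, rfl⟩ : ∃ s, t = 2 * s + 1 := ⟨t / 2, by simp at hi; omega⟩
      exact hq s
    · obtain ⟨s, rfl⟩ : ∃ s, t = 4 * s + 2 := ⟨t / 4, by simp at hi; omega⟩
      exact h2 s
    · obtain ⟨s, rfl⟩ : ∃ s, t = 2 * s + 1 := ⟨t / 2, by simp at hi; omega⟩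
      exact hq s
  · rintro m ⟨hm, r, hr⟩
    by_contra hm4
    push Not at hm4
    apply hne
    -- Each of 1, 2, 3 divides 6, so 12k and 12k + 6 lie in one class modulo m, although they are 0
    -- and 2 modulo 4.
    have h6 : (6 : ℕ) % m = 0 := by interval_cases m <;> rfl
    have h12 : ∀ k, (12 * k) % m = 0 := fun k =>
      Nat.mod_eq_zero_of_dvd (((Nat.dvd_of_mod_eq_zero h6).trans (by norm_num)).mul_right k)
    have e0 : p₀ = r ⟨0, hm⟩ := eq_of_eval_arith_eq 12 0 (by norm_num) fun k => by
      rw [add_zero, ← hr (12 * k) ⟨0, hm⟩ (h12 k), show 12 * k = 4 * (3 * k) by ring, h0]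
    have e2 : p₂ = r ⟨0, hm⟩ := eq_of_eval_arith_eq 12 6 (by norm_num) fun k => by
      rw [← hr (12 * k + 6) ⟨0, hm⟩ (by rw [Nat.add_mod, h12, h6]; simp),
        show 12 * k + 6 = 4 * (3 * k + 1) + 2 by ring, h2]
    rw [e0, e2]

theorem pow_add_mul_inv_pow {x : ℝ} (hx : x ≠ 0) (c : ℝ) (h i : ℕ) :
    x ^ (i + h) * c * x⁻¹ ^ i = x ^ h * c := by
  have : x ^ i * x⁻¹ ^ i = 1 := by rw [← mul_pow, mul_inv_cancel₀ hx, one_pow]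
  rw [pow_add]
  linear_combination (x ^ h * c) * this

theorem pow_mul_inv_pow_succ {x : ℝ} (hx : x ≠ 0) (c : ℝ) (e : ℕ) :
    x ^ e * c * x⁻¹ ^ (e + 1) = x⁻¹ * c := by
  have : x ^ e * x⁻¹ ^ e = 1 := by rw [← mul_pow, mul_inv_cancel₀ hx, one_pow]
  rw [pow_succ]
  linear_combination (x⁻¹ * c) * this

theorem normEven_ne_zero {s j : ℕ} (hj : j < s + 1) : normEven s j ≠ 0 := by
  have hs : ((s : ℝ) + 1) ≠ 0 := by positivity
  have := (sin_nat_mul_pi_div_pos (n := 2 * s + 2) (j := j + 1) (by omega) (by omega)).ne'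
  unfold normEven
  split_ifs
  · exact hs
  · exact div_ne_zero hs (mul_ne_zero two_ne_zero (pow_ne_zero 2 this))

theorem normOdd_ne_zero {s k : ℕ} (hk : k < s + 1) : normOdd s k ≠ 0 := by
  obtain ⟨hy, hz⟩ := sin_cos_ne_zero hk
  rw [normOdd_eq]
  positivity

open Polynomial in
-- Only the middle class sees the parity of s. Relative to the cosecant part `b`, an even s
-- contributes the correction `c`: the true middle term minus half of the generic expression already
-- counted in `b`.
theorem exists_polynomial_even_leaf (h l : ℕ) : ∃ p₀ p₂ : ℝ[X], p₀ ≠ p₂ ∧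
    (∀ s : ℕ, Even s → ∑ j ∈ range (s + 1), normEven s j ^ h * leafEven s j ^ (l + 1) =
      p₀.eval ((2 * s : ℕ) : ℝ)) ∧
    (∀ s : ℕ, ¬ Even s → ∑ j ∈ range (s + 1), normEven s j ^ h * leafEven s j ^ (l + 1) =
      p₂.eval ((2 * s : ℕ) : ℝ)) := by
  obtain ⟨p, hp⟩ := exists_polynomial_cscSum (h + (l + 1))
  let b : ℝ[X] := C (1 / 2) * (C (1 / 4) * (X + C 2)) ^ h *
    (p.comp (X + C 2) - p.comp (C (1 / 2) * (X + C 2)))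
  let c : ℝ[X] := (C (1 / 2) * (X + C 2)) ^ h - C (1 / 2) * (C (1 / 4) * (X + C 2)) ^ h
  have hb : ∀ s : ℕ, b.eval ((2 * s : ℕ) : ℝ) = ((s + 1) / 2) ^ h *
      ((cscSum (h + (l + 1)) (2 * s + 2) - cscSum (h + (l + 1)) (s + 1)) / 2) := by
    intro s
    rw [hp _ (by omega), hp _ (by omega)]
    simp only [b, eval_mul, eval_sub, eval_pow, eval_comp, eval_add, eval_C, eval_X]
    have e1 : ((2 * s : ℕ) : ℝ) + 2 = (2 * s + 2 : ℕ) := by push_cast; ring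
    have e2 : (1 / 2 * ((2 * s + 2 : ℕ) : ℝ)) = (s + 1 : ℕ) := by push_cast; ring
    have e3 : (1 / 4 * ((2 * s + 2 : ℕ) : ℝ)) = ((s : ℝ) + 1) / 2 := by push_cast; ring
    rw [e1, e2, e3]
    ring
  have hc : ∀ s : ℕ, c.eval ((2 * s : ℕ) : ℝ) = (s + 1) ^ h - 1 / 2 * ((s + 1) / 2) ^ h := by
    intro s
    simp only [c, eval_mul, eval_sub, eval_pow, eval_add, eval_C, eval_X]
    have e2 : (1 / 2 * (((2 * s : ℕ) : ℝ) + 2)) = s + 1 := by push_cast; ring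
    have e3 : (1 / 4 * (((2 * s : ℕ) : ℝ) + 2)) = ((s : ℝ) + 1) / 2 := by push_cast; ring
    rw [e2, e3]
  refine ⟨b + c, b, ?_, fun s hs => ?_, fun s hs => ?_⟩
  · intro hbc
    have h0 : c = 0 := by simpa using hbc
    -- At s = 1 the correction is 2^h - 1/2, which is not 0.
    have h1 := hc 1
    rw [h0, eval_zero] at h1
    have h2 : (1 : ℝ) ≤ 2 ^ h := one_le_pow₀ (by norm_num)
    norm_num at h1
    linarith
  · rw [sum_normEven_pow_mul_leafEven_pow, eval_add, hb, hc, if_pos hs]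
    ring
  · rw [sum_normEven_pow_mul_leafEven_pow, hb, if_neg hs]
    ring

/-! ### Cubic graphs and the graph with a single edge -/

namespace Graph

variable {α β : Type*} {G : Graph α β}

theorem ncard_edgeSet_eq_card [Fintype E(G)] : E(G).ncard = Fintype.card E(G) := by
  rw [← Nat.card_coe_set_eq, Nat.card_eq_fintype_card]

theorem IsCubic.internalNodes_eq (h : G.IsCubic) : G.internalNodes = V(G) :=
  Set.Subset.antisymm (fun _ hv => hv.1) fun v hv => ⟨hv, h v hv⟩

/-- A connected graph all of whose vertices are leaves is a single edge. -/
theorem exists_single_edge [Fintype E(G)] (h13 : G.IsOneThree) (hconn : G.IsConnected)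
    (hI : ¬ G.internalNodes.Nonempty) :
    ∃ e x y, x ≠ y ∧ V(G) = {x, y} ∧ E(G) = {e} := by
  rw [Set.not_nonempty_iff_eq_empty] at hI
  have hd : ∀ v ∈ V(G), G.degree v = 1 := fun v hv => h13.degree_eq_one hv (by simp [hI])
  obtain ⟨x, hx⟩ := hconn.1
  obtain ⟨e, y, hl⟩ := exists_inc_of_degree_pos (G := G) (v := x) (by rw [hd x hx]; norm_num)
  have hV : ∀ v ∈ V(G), v = x ∨ v = y := fun v hv =>
    hconn.eq_or_eq_of_isLink_leaves hl (hd x hx) (hd y hl.right_mem) hv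
  refine ⟨e, x, y, ?_, ?_, ?_⟩
  · rintro rfl
    exact not_isLoopAt_of_degree_eq_one (hd x hx) e hl
  · refine Set.Subset.antisymm (fun v hv => hV v hv) ?_
    rintro v (rfl | rfl)
    exacts [hx, hl.right_mem]
  · refine Set.Subset.antisymm (fun f hf => ?_) (by rintro f rfl; exact hl.edge_mem)
    obtain ⟨u, v, huv⟩ := G.exists_isLink_of_mem_edgeSet hf
    rcases hV u huv.left_mem with rfl | rfl
    · exact edge_eq_of_degree_eq_one (hd _ hx) huv.inc_left hl.inc_left
    · exact edge_eq_of_degree_eq_one (hd _ hl.right_mem) huv.inc_left hl.inc_right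

theorem ehrhart_polytopeP_single_edge (hI : ¬ G.internalNodes.Nonempty) {e : β}
    (he : E(G) = {e}) (t : ℕ) : ehrhart G.polytopeP t = t / 2 + 1 := by
  have heE : e ∈ E(G) := by rw [he]; rfl
  have hall : ∀ f : E(G), f = ⟨e, heE⟩ := fun f =>
    Subtype.ext (he.subset f.2)
  have hcomp : G.IsEdgeComponent ⟨e, heE⟩ := by
    intro f x _ hf
    have := hf.edge_mem
    rw [he] at this
    exact this
  rw [Set.not_nonempty_iff_eq_empty] at hI
  have hP : G.polytopeP = {w | 0 ≤ w ⟨e, heE⟩ ∧ w ⟨e, heE⟩ ≤ 1 / 2} := by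
    ext w
    simp only [polytopeP, hI, Set.mem_empty_iff_false, false_imp_iff, implies_true, true_and,
      Set.mem_ofPred_eq]
    constructor
    · exact fun h => h _ hcomp
    · intro h f _
      rw [hall f]
      exact h
  have hset : {z : E(G) → ℤ | (fun i => (z i : ℝ)) ∈ (t : ℝ) • G.polytopeP} =
      (fun k _ => k) '' ((Finset.Icc (0 : ℤ) (t / 2 : ℕ) : Finset ℤ) : Set ℤ) := by
    ext z
    have hz : (fun i => (z i : ℝ)) ∈ (t : ℝ) • G.polytopeP ↔
        0 ≤ z ⟨e, heE⟩ ∧ 2 * z ⟨e, heE⟩ ≤ t := by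
      rw [hP]
      rcases eq_or_ne t 0 with rfl | ht
      · rw [Nat.cast_zero, Set.zero_smul_set ⟨0, by simp⟩, Set.mem_zero]
        constructor
        · intro h
          have : z ⟨e, heE⟩ = 0 := Int.cast_eq_zero.1 (congrFun h ⟨e, heE⟩)
          simp [this]
        · intro h
          funext f
          rw [hall f]
          have : z ⟨e, heE⟩ = 0 := by omega
          simp [this]
      · have ht' : (0 : ℝ) < t := by positivity
        rw [intCast_mem_smul_iff ht]
        simp only [Set.mem_ofPred_eq]
        rw [le_div_iff₀ ht', div_le_iff₀ ht', zero_mul]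
        refine and_congr (by norm_cast) ?_
        rw [show ((z ⟨e, heE⟩ : ℝ) ≤ 1 / 2 * t) ↔ (2 * (z ⟨e, heE⟩ : ℝ) ≤ t) by
          constructor <;> intro h <;> linarith]
        norm_cast
    simp only [Set.mem_ofPred_eq, hz, Set.mem_image, coe_Icc, Set.mem_Icc]
    constructor
    · intro h
      refine ⟨z ⟨e, heE⟩, ⟨h.1, by omega⟩, ?_⟩
      funext f
      rw [hall f]
    · rintro ⟨k, hk, rfl⟩
      simp only
      omega
  have hinj : Function.Injective (fun (k : ℤ) (_ : E(G)) => k) :=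
    fun k l h => congrFun h ⟨e, heE⟩
  rw [ehrhart, hset, Set.ncard_image_of_injective _ hinj, Set.ncard_coe_finset, Int.card_Icc]
  omega

theorem exists_hasPeriod_single_edge (hI : ¬ G.internalNodes.Nonempty) {e : β}
    (he : E(G) = {e}) : ∃ n ≤ 2, HasPeriod (ehrhart G.polytopeP) n := by
  refine exists_hasPeriod_le_two (p := Polynomial.C (1 / 2) * Polynomial.X + 1)
    (q := Polynomial.C (1 / 2) * (Polynomial.X + 1)) (fun s => ?_) (fun s => ?_)
  · rw [ehrhart_polytopeP_single_edge hI he, show 2 * s / 2 = s by omega]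
    simp
  · rw [ehrhart_polytopeP_single_edge hI he, show (2 * s + 1) / 2 = s by omega]
    simp
    ring

end Graph

/-! ### The theorem, by cases on trees, cubic graphs and the rest -/

theorem mainTheorem1 {α β : Type*} (G : Graph α β)
    (hV : G.vertexSet.Finite) (hE : G.edgeSet.Finite)
    (h13 : G.IsOneThree) (hconn : G.IsConnected) :
    (G.IsTree ∨ G.IsCubic → ∃ n ≤ 2, HasPeriod (ehrhart G.polytopeP) n) ∧
    (¬ (G.IsTree ∨ G.IsCubic) → HasPeriod (ehrhart G.polytopeP) 4) ∧
    (G.IsCubic →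
      ∃ (p : Fin 4 → Polynomial ℝ) (q : Fin 2 → Polynomial ℝ),
        IsConstituents (ehrhart G.polytopeP) p ∧
        IsConstituents (ehrhart G.polytopeQ) q ∧
        ∀ t : ℝ,
          (q 0).eval t = G.numInternallyEulerian * (p 0).eval t -
            (G.numInternallyEulerian - 1) * (t / 2 + 1) ^ (G.cyclomaticNumber - 1) ∧
          (q 0).eval t = G.numInternallyEulerian * (p 2).eval t -
            (G.numInternallyEulerian - 1) * (t / 2 + 1) ^ (G.cyclomaticNumber - 1)) := by
  have : Fintype E(G) := hE.fintype
  have : Fintype G.internalNodes := (hV.subset fun v hv => hv.1).fintype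
  by_cases hI : G.internalNodes.Nonempty
  swap
  · obtain ⟨e, x, y, hxy, hVe, hEe⟩ := Graph.exists_single_edge h13 hconn hI
    have hcub : ¬ G.IsCubic := by
      intro h
      rw [h.internalNodes_eq] at hI
      exact hI hconn.1
    refine ⟨fun _ => Graph.exists_hasPeriod_single_edge hI hEe, fun h => ?_,
      fun h => absurd h hcub⟩
    exfalso
    have hac : ¬ G.IsAcyclic := fun hac => h (Or.inl ⟨hconn, hac⟩)
    have := hconn.ncard_vertexSet_le_of_not_isAcyclic hE hac
    rw [hVe, hEe, Set.ncard_pair hxy, Set.ncard_singleton] at this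
    omega
  have : Nonempty G.internalNodes := hI.to_subtype
  obtain ⟨N, hN, hle, hcardV⟩ := Graph.exists_trivalentNet hV h13 hconn hI
  have hshake := N.three_mul_card
  have heven : ∀ s : ℕ, (ehrhart G.polytopeP (2 * s) : ℝ) = _ := fun s =>
    (congrArg Nat.cast (Graph.ehrhart_polytopeP_eq h13 hconn hI hN (2 * s))).trans
      (N.ncard_triangle_even s)
  have hodd : ∀ s : ℕ, (ehrhart G.polytopeP (2 * s + 1) : ℝ) = _ := fun s =>
    (congrArg Nat.cast (Graph.ehrhart_polytopeP_eq h13 hconn hI hN (2 * s + 1))).trans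
      (N.ncard_triangle_odd s)
  have hcardE := Graph.ncard_edgeSet_eq_card (G := G)
  -- With h the cyclomatic number minus 1, the norms cancel to the power h. Trees, where this
  -- exponent is -1, are treated separately.
  have hlow : ∀ h, #N.internal = Fintype.card G.internalNodes + h →
      (∀ s : ℕ, (ehrhart G.polytopeP (2 * s) : ℝ) = ∑ j ∈ range (s + 1),
        normEven s j ^ h * leafEven s j ^ (Fintype.card E(G) - #N.internal)) ∧
      (∀ s : ℕ, (ehrhart G.polytopeP (2 * s + 1) : ℝ) = ∑ k ∈ range (s + 1),
        normOdd s k ^ h * leafOdd s k ^ (Fintype.card E(G) - #N.internal)) := by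
    intro h hh
    constructor
    · intro s
      rw [heven]
      refine sum_congr rfl fun j hj => ?_
      rw [← pow_add_mul_inv_pow (normEven_ne_zero (mem_range.1 hj)) _ h
        (Fintype.card G.internalNodes), ← hh]
    · intro s
      rw [hodd]
      refine sum_congr rfl fun k hk => ?_
      rw [← pow_add_mul_inv_pow (normOdd_ne_zero (mem_range.1 hk)) _ h
        (Fintype.card G.internalNodes), ← hh]
  have hcubic : G.IsCubic → Fintype.card E(G) = #N.internal ∧
      ∃ h, #N.internal = Fintype.card G.internalNodes + h ∧ G.cyclomaticNumber = h + 1 := by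
    intro hc
    have h1 : V(G).ncard = Fintype.card G.internalNodes := by
      rw [← hc.internalNodes_eq, ← Nat.card_coe_set_eq, Nat.card_eq_fintype_card]
    have h2 : Fintype.card E(G) = #N.internal := by omega
    refine ⟨h2, #N.internal - Fintype.card G.internalNodes, by omega, ?_⟩
    unfold Graph.cyclomaticNumber
    omega
  have hcubic_poly : ∀ (h : ℕ), Fintype.card E(G) = #N.internal →
      #N.internal = Fintype.card G.internalNodes + h → ∀ p : Polynomial ℝ,
      (∀ n : ℕ, 0 < n → cscSum h n = p.eval (n : ℝ)) →
      ∀ s : ℕ, (ehrhart G.polytopeP (2 * s) : ℝ) =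
        (Polynomial.C (1 / 2) * (Polynomial.C (1 / 4) * (Polynomial.X + Polynomial.C 2)) ^ h *
          (p.comp (Polynomial.X + Polynomial.C 2) - 1) +
          (Polynomial.C (1 / 2) * (Polynomial.X + Polynomial.C 2)) ^ h).eval
            ((2 * s : ℕ) : ℝ) := by
    intro h hl hh p hp s
    rw [(hlow h hh).1 s, hl, Nat.sub_self]
    simp only [pow_zero, mul_one]
    rw [sum_normEven_pow, hp _ (by omega)]
    simp only [Polynomial.eval_mul, Polynomial.eval_sub, Polynomial.eval_pow,
      Polynomial.eval_comp, Polynomial.eval_add, Polynomial.eval_C, Polynomial.eval_X,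
      Polynomial.eval_one]
    have e1 : ((2 * s : ℕ) : ℝ) + 2 = (2 * s + 2 : ℕ) := by push_cast; ring
    have e2 : (1 / 2 * ((2 * s + 2 : ℕ) : ℝ)) = (s : ℝ) + 1 := by push_cast; ring
    have e3 : (1 / 4 * ((2 * s + 2 : ℕ) : ℝ)) = ((s : ℝ) + 1) / 2 := by push_cast; ring
    rw [e1, e2, e3]
    ring
  refine ⟨?_, ?_, ?_⟩
  · rintro (ht | hc)
    · have h1 := ht.ncard_edgeSet_add_one hV hE
      have h2 : Fintype.card G.internalNodes = #N.internal + 1 := by omega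
      -- The handshake identity gives a tree with an internal node at least three leaves.
      obtain ⟨l, hl⟩ : ∃ l, Fintype.card E(G) - #N.internal = l + 2 :=
        ⟨Fintype.card E(G) - #N.internal - 2, by omega⟩
      obtain ⟨p, hp⟩ := exists_polynomial_even_tree (l + 1)
      obtain ⟨q, hq⟩ := exists_polynomial_odd_tree l
      refine exists_hasPeriod_le_two (p := p) (q := q) (fun s => ?_) (fun s => ?_)
      · rw [heven, ← hp]
        refine sum_congr rfl fun j hj => ?_
        rw [hl, h2, pow_mul_inv_pow_succ (normEven_ne_zero (mem_range.1 hj))]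
      · rw [hodd, ← hq]
        refine sum_congr rfl fun k hk => ?_
        rw [hl, h2, pow_mul_inv_pow_succ (normOdd_ne_zero (mem_range.1 hk))]
    · obtain ⟨hl, h, hh, -⟩ := hcubic hc
      obtain ⟨p, hp⟩ := exists_polynomial_cscSum h
      obtain ⟨q, hq⟩ := exists_polynomial_odd h (Fintype.card E(G) - #N.internal)
      exact exists_hasPeriod_le_two (hcubic_poly h hl hh p hp)
        fun s => ((hlow h hh).2 s).trans (hq s)
  · intro hnot
    push Not at hnot
    have h1 := hconn.ncard_vertexSet_le_of_not_isAcyclic hE fun hac => hnot.1 ⟨hconn, hac⟩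
    -- A graph that is not cubic has a leaf, so the exponent of the leaf weights is positive.
    have h2 : Fintype.card G.internalNodes < V(G).ncard := by
      rw [← Nat.card_eq_fintype_card, Nat.card_coe_set_eq]
      refine Set.ncard_lt_ncard ⟨fun v hv => hv.1, fun hsub => hnot.2 fun v hv => ?_⟩ hV
      exact (hsub hv).2
    obtain ⟨l, hl⟩ : ∃ l, Fintype.card E(G) - #N.internal = l + 1 :=
      ⟨Fintype.card E(G) - #N.internal - 1, by omega⟩
    obtain ⟨h, hh⟩ : ∃ h, #N.internal = Fintype.card G.internalNodes + h :=
      ⟨#N.internal - Fintype.card G.internalNodes, by omega⟩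
    have hlow' := hlow h hh
    rw [hl] at hlow'
    obtain ⟨p₀, p₂, hne, hp₀, hp₂⟩ := exists_polynomial_even_leaf h l
    obtain ⟨q, hq⟩ := exists_polynomial_odd h (l + 1)
    refine hasPeriod_four (p₀ := p₀) (p₂ := p₂) (q := q) (fun s => ?_) (fun s => ?_)
      (fun s => (hlow'.2 s).trans (hq s)) hne
    · rw [show 4 * s = 2 * (2 * s) by ring, hlow'.1, hp₀ _ (even_two_mul s)]
    · rw [show 4 * s + 2 = 2 * (2 * s + 1) by ring, hlow'.1, hp₂ _ (by simp)]
  · intro hc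
    obtain ⟨hl, h, hh, hcyc⟩ := hcubic hc
    obtain ⟨p, hp⟩ := exists_polynomial_cscSum h
    obtain ⟨po, hpo⟩ := exists_polynomial_odd h (Fintype.card E(G) - #N.internal)
    have hpe := hcubic_poly h hl hh p hp
    -- Without leaves both characters of the group of order 2 contribute 2^h.
    have hnum : (G.numInternallyEulerian : ℝ) = 2 ^ (h + 1) := by
      rw [Graph.numInternallyEulerian_eq hN, N.ncard_even, hl, Nat.sub_self, hh,
        pow_add_mul_inv_pow two_ne_zero, pow_add_mul_inv_pow two_ne_zero]
      simp only [pow_zero]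
      ring
    set pe : Polynomial ℝ :=
      Polynomial.C (1 / 2) * (Polynomial.C (1 / 4) * (Polynomial.X + Polynomial.C 2)) ^ h *
          (p.comp (Polynomial.X + Polynomial.C 2) - 1) +
          (Polynomial.C (1 / 2) * (Polynomial.X + Polynomial.C 2)) ^ h with hpe_def
    set q : Polynomial ℝ := (Polynomial.C (1 / 2) * (Polynomial.X + Polynomial.C 2)) ^ h *
      p.comp (Polynomial.X + Polynomial.C 2) with hq_def
    have hQ : ∀ t : ℕ, (ehrhart G.polytopeQ t : ℝ) = q.eval (t : ℝ) := by
      intro t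
      rw [Graph.ehrhart_polytopeQ_eq h13 hconn hI hN, N.ncard_evenTriangle, hl, Nat.sub_self, hh]
      simp only [hq_def, Polynomial.eval_mul, Polynomial.eval_pow,
        Polynomial.eval_comp, Polynomial.eval_add, Polynomial.eval_C, Polynomial.eval_X]
      rw [show (t : ℝ) + 2 = (t + 2 : ℕ) by push_cast; ring, ← hp _ (by omega), cscSum, mul_sum]
      refine sum_congr rfl fun j hj => ?_
      have hj' := mem_range.1 hj
      have hs := sin_nat_mul_pi_div_pos (n := t + 2) (j := j + 1) (by omega) (by omega)
      rw [pow_add_mul_inv_pow (by positivity), pow_zero, mul_one, ← mul_pow]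
      congr 1
      ring
    -- One polynomial serves all even t, one serves all odd t, and for Q a single polynomial serves
    -- every t.
    refine ⟨![pe, po, pe, po], ![q, q], fun t i hi => ?_, fun t i _ => ?_, fun t => ?_⟩
    · fin_cases i
      · obtain ⟨s, rfl⟩ : ∃ s, t = 2 * s := ⟨t / 2, by simp at hi; omega⟩
        exact hpe s
      · obtain ⟨s, rfl⟩ : ∃ s, t = 2 * s + 1 := ⟨t / 2, by simp at hi; omega⟩
        exact ((hlow h hh).2 s).trans (hpo s)
      · obtain ⟨s, rfl⟩ : ∃ s, t = 2 * s := ⟨t / 2, by simp at hi; omega⟩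
        exact hpe s
      · obtain ⟨s, rfl⟩ : ∃ s, t = 2 * s + 1 := ⟨t / 2, by simp at hi; omega⟩
        exact ((hlow h hh).2 s).trans (hpo s)
    · fin_cases i <;> exact hQ t
    · have key : q.eval t = G.numInternallyEulerian * pe.eval t -
          (G.numInternallyEulerian - 1) * (t / 2 + 1) ^ (G.cyclomaticNumber - 1) := by
        rw [hnum, hcyc, Nat.add_sub_cancel]
        simp only [hq_def, hpe_def, Polynomial.eval_mul, Polynomial.eval_pow, Polynomial.eval_sub,
          Polynomial.eval_comp, Polynomial.eval_add, Polynomial.eval_C, Polynomial.eval_X,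
          Polynomial.eval_one]
        have e2 : 1 / 2 * (t + 2) = t / 2 + 1 := by ring
        have e4 : (2 : ℝ) ^ h * (1 / 4 * (t + 2)) ^ h = (t / 2 + 1) ^ h := by
          rw [← mul_pow]
          congr 1
          ring
        rw [e2, pow_succ]
        linear_combination (1 - p.eval (t + 2)) * e4
      exact ⟨key, key⟩
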